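/- Let $d$ be a natural number. For $t\in\mathbb R_+^d=(0,\infty)^d$ let $D_t(0)=\{z\in\mathbb C^d: |z_j|<t_j,\ j=1,\dots,d\}$. Let $\mathcal R^\infty(\mathbb C^d)$ be the set of all non-negative $\chi\in L^\infty(\mathbb C^d)$ for which there are $t_1,t_2\in\mathbb R_+^d$ with $t_1\le t_2$ (componentwise), a constant $c>0$ and a function $\chi_0$ such that $\chi$ is supported in $\overline{D_{t_2}(0)}$, $\chi(z)=\chi_0(|z_1|,\dots,|z_d|)$, and $\chi\ge c$ on $D_{t_1}(0)$ (all up to null sets). Write $\chi(x,\xi)=\chi(x+i\xi)$ for $x,\xi\in\mathbb R^d$. Let $h_\alpha(x)=\pi^{-d/4}(-1)^{|\alpha|}(2^{|\alpha|}\alpha!)^{-1/2}e^{|x|^2/2}\,\partial^\alpha e^{-|x|^2}$, $\alpha\in\mathbb N^d$, be the Hermite functions, and let $\mathcal H_{0,\flat_1}(\mathbb R^d)$ be the set of all $f\in L^2(\mathbb R^d)$ such that for every $r\in\mathbb R_+^d$ there is a constant $C$ with $|(f,h_\alpha)_{L^2}|\le C\,r^\alpha(\alpha!)^{-1/2}$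 for all $\alpha\in\mathbb N^d$. Let $\phi(x)=\pi^{-d/4}e^{-|x|^2/2}$, let $V_\phi h(x,\xi)=\int_{\mathbb R^d}h(y)\,\phi(y-x)\,e^{-i\langle y,\xi\rangle}\,dy$, and for bounded measurable compactly supported $F$ on $\mathbb R^{2d}$ let $V_\phi^*F\in\mathscr S'(\mathbb R^d)$ be the tempered distribution given by $(V_\phi h,F)_{L^2(\mathbb R^{2d})}=(h,V_\phi^*F)_{L^2(\mathbb R^d)}$ for all $h\in\mathscr S(\mathbb R^d)$. **Proposition.** Let $\chi\in\mathcal R^\infty(\mathbb C^d)$ and let $f\in\mathscr S'(\mathbb R^d)$. Then the following conditions are equivalent: 1. $f\in\mathcal H_{0,\flat_1}(\mathbb R^d)$; 2. $f=V_\phi^*F$ for some $F\in\mathscr E'(\mathbb R^{2d})\cap L^\infty(\mathbb R^{2d})$ (that is, $F$ is essentially bounded and vanishes almost everywhere outside some compact set) such that, for some entire function $F_0$ on $\mathbb C^d$, $$F(x,\xi)=F_0(x-i\xi)\,e^{-i\langle x,\xi\rangle}\,\chi(x,\xi)\quad\text{for almost every }(x,\xi)\in\mathbb R^{2d}.$$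 -/

import Mathlib

noncomputable section

/-- The Gaussian window `φ(x) = π^{-d/4} e^{-|x|²/2}` on `ℝ^d`. -/
def gaussWindow (d : ℕ) (x : EuclideanSpace ℝ (Fin d)) : ℝ :=
  Real.pi ^ (-(d : ℝ) / 4) * Real.exp (-‖x‖ ^ 2 / 2)

/-- The Hermite function
`h_α(x) = π^{-d/4} (-1)^{|α|} (2^{|α|} α!)^{-1/2} e^{|x|²/2} ∂^α (e^{-|x|²})`, where
`∂^α (e^{-|x|²})` is written as the product of the derivatives of `t ↦ e^{-t²}` of order `α_j`
at `x_j`. -/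
def hermiteFun {d : ℕ} (α : Fin d → ℕ) (x : EuclideanSpace ℝ (Fin d)) : ℝ :=
  Real.pi ^ (-(d : ℝ) / 4) * (-1) ^ (∑ j, α j) *
    (2 ^ (∑ j, α j) * ∏ j, ((α j).factorial : ℝ)) ^ (-(1 / 2 : ℝ)) *
    Real.exp (‖x‖ ^ 2 / 2) *
    ∏ j, iteratedDeriv (α j) (fun t : ℝ => Real.exp (-t ^ 2)) (x j)

/-- The Hermite coefficient `c_h(u, α) = (u, h_α)_{L²}`. -/
def hermiteCoeff {d : ℕ} (u : EuclideanSpace ℝ (Fin d) → ℂ) (α : Fin d → ℕ) : ℂ :=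
  ∫ x, u x * (hermiteFun α x : ℂ)

/-- The weight `ϑ_{r,♭_σ}(α) = r^α (α!)^{-1/(2σ)}`. -/
def thetaFlat {d : ℕ} (σ : ℝ) (r : Fin d → ℝ) (α : Fin d → ℕ) : ℝ :=
  (∏ j, r j ^ α j) * (∏ j, ((α j).factorial : ℝ)) ^ (-(1 / (2 * σ)))

/-- The Beurling type Pilipović space `H_{0,♭_σ}(ℝ^d)`, as a set of tempered distributions:
all `f ∈ L²(ℝ^d)` such that for every `r ∈ ℝ_+^d` one has `|c_h(f, α)| ≤ C ϑ_{r,♭_σ}(α)` for all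
`α`, with a constant `C` that does not depend on `α`. -/
def pilipovicBeurlingFlat (d : ℕ) (σ : ℝ) :
    Set (TemperedDistribution (EuclideanSpace ℝ (Fin d)) ℂ) :=
  {f | ∃ u : MeasureTheory.Lp ℂ 2 (MeasureTheory.volume : MeasureTheory.Measure
        (EuclideanSpace ℝ (Fin d))),
      f = MeasureTheory.Lp.toTemperedDistribution u ∧
      ∀ r : Fin d → ℝ, (∀ j, 0 < r j) →
        ∃ C : ℝ, ∀ α : Fin d → ℕ, ‖hermiteCoeff u α‖ ≤ C * thetaFlat σ r α}

/-- The short-time Fourier transform with window `φ`: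
`V_φ f(x, ξ) = ∫ f(y) φ(y - x) e^{-i⟨y, ξ⟩} dy` (the window is real-valued). -/
def stft {d : ℕ} (f : EuclideanSpace ℝ (Fin d) → ℂ)
    (p : EuclideanSpace ℝ (Fin d) × EuclideanSpace ℝ (Fin d)) : ℂ :=
  ∫ y, f y * (gaussWindow d (y - p.1) : ℂ) *
    Complex.exp (-(Complex.I * ((inner ℝ y p.2 : ℝ) : ℂ)))

theorem gaussWindow_continuous (d : ℕ) : Continuous (gaussWindow d) := by
  unfold gaussWindow
  fun_prop

theorem gaussWindow_nonneg (d : ℕ) (x : EuclideanSpace ℝ (Fin d)) : 0 ≤ gaussWindow d x := by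
  unfold gaussWindow
  positivity

theorem gaussWindow_integrable (d : ℕ) :
    MeasureTheory.Integrable (gaussWindow d) := by
  have h := GaussianFourier.integrable_cexp_neg_mul_sq_norm_add (V := EuclideanSpace ℝ (Fin d))
    (b := (1 / 2 : ℂ)) (by norm_num) 0 0
  have h2 := (h.norm).const_mul (Real.pi ^ (-(d : ℝ) / 4))
  refine h2.congr (Filter.Eventually.of_forall fun x => ?_)
  simp only [gaussWindow, Complex.norm_exp]
  congr 2
  have : (-(1 / 2 : ℂ) * (‖x‖ : ℂ) ^ 2 + 0 * ((inner ℝ 0 x : ℝ) : ℂ)) =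
      ((-‖x‖ ^ 2 / 2 : ℝ) : ℂ) := by
    push_cast; ring
  rw [this, Complex.ofReal_re]

theorem stft_integrand_norm {d : ℕ} (f : EuclideanSpace ℝ (Fin d) → ℂ)
    (p : EuclideanSpace ℝ (Fin d) × EuclideanSpace ℝ (Fin d)) (y : EuclideanSpace ℝ (Fin d)) :
    ‖f y * (gaussWindow d (y - p.1) : ℂ) *
      Complex.exp (-(Complex.I * ((inner ℝ y p.2 : ℝ) : ℂ)))‖ =
      ‖f y‖ * gaussWindow d (y - p.1) := by
  rw [norm_mul, norm_mul, Complex.norm_exp, Complex.norm_real,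
    Real.norm_of_nonneg (gaussWindow_nonneg d _)]
  simp

theorem stft_integrand_continuous {d : ℕ} {f : EuclideanSpace ℝ (Fin d) → ℂ} (hf : Continuous f) :
    Continuous fun q : (EuclideanSpace ℝ (Fin d) × EuclideanSpace ℝ (Fin d)) ×
        EuclideanSpace ℝ (Fin d) =>
      f q.2 * (gaussWindow d (q.2 - q.1.1) : ℂ) *
        Complex.exp (-(Complex.I * ((inner ℝ q.2 q.1.2 : ℝ) : ℂ))) := by
  have := gaussWindow_continuous d
  fun_prop

theorem stft_integrand_integrable {d : ℕ} {f : EuclideanSpace ℝ (Fin d) → ℂ} (hf : Continuous f)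
    {M : ℝ} (hM : ∀ y, ‖f y‖ ≤ M)
    (p : EuclideanSpace ℝ (Fin d) × EuclideanSpace ℝ (Fin d)) :
    MeasureTheory.Integrable fun y => f y * (gaussWindow d (y - p.1) : ℂ) *
      Complex.exp (-(Complex.I * ((inner ℝ y p.2 : ℝ) : ℂ))) := by
  refine (((gaussWindow_integrable d).comp_sub_right p.1).const_mul M).mono' ?_ ?_
  · exact ((stft_integrand_continuous hf).comp
      (Continuous.prodMk_right p)).aestronglyMeasurable
  · refine Filter.Eventually.of_forall fun y => ?_
    rw [stft_integrand_norm]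
    exact mul_le_mul_of_nonneg_right (hM y) (gaussWindow_nonneg d _)

theorem norm_stft_le {d : ℕ} {f : EuclideanSpace ℝ (Fin d) → ℂ}
    {M : ℝ} (hM : ∀ y, ‖f y‖ ≤ M)
    (p : EuclideanSpace ℝ (Fin d) × EuclideanSpace ℝ (Fin d)) :
    ‖stft f p‖ ≤ M * ∫ y, gaussWindow d y := by
  unfold stft
  refine (MeasureTheory.norm_integral_le_of_norm_le
    (((gaussWindow_integrable d).comp_sub_right p.1).const_mul M)
    (Filter.Eventually.of_forall fun y => ?_)).trans_eq ?_
  · rw [stft_integrand_norm]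
    exact mul_le_mul_of_nonneg_right (hM y) (gaussWindow_nonneg d _)
  · rw [MeasureTheory.integral_const_mul,
      MeasureTheory.integral_sub_right_eq_self (gaussWindow d) p.1]

theorem stft_stronglyMeasurable {d : ℕ} {f : EuclideanSpace ℝ (Fin d) → ℂ} (hf : Continuous f) :
    MeasureTheory.StronglyMeasurable (stft f) :=
  MeasureTheory.StronglyMeasurable.integral_prod_right'
    (stft_integrand_continuous hf).stronglyMeasurable

theorem stftAdjoint_integrable {d : ℕ}
    {F : EuclideanSpace ℝ (Fin d) × EuclideanSpace ℝ (Fin d) → ℂ}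
    (hF : MeasureTheory.Integrable F) (g : SchwartzMap (EuclideanSpace ℝ (Fin d)) ℂ) :
    MeasureTheory.Integrable fun p => F p * star (stft (fun y => star (g y)) p) := by
  have hg : Continuous fun y => star (g y) := g.continuous.star
  refine hF.mul_bdd (c := SchwartzMap.seminorm ℂ 0 0 g * ∫ y, gaussWindow d y)
    (continuous_star.comp_stronglyMeasurable (stft_stronglyMeasurable hg)).aestronglyMeasurable
    (Filter.Eventually.of_forall fun p => ?_)
  rw [norm_star]
  exact norm_stft_le (fun y => by rw [norm_star]; exact SchwartzMap.norm_le_seminorm ℂ g y) p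

theorem stft_star_add {d : ℕ} (g h : SchwartzMap (EuclideanSpace ℝ (Fin d)) ℂ)
    (p : EuclideanSpace ℝ (Fin d) × EuclideanSpace ℝ (Fin d)) :
    stft (fun y => star ((g + h) y)) p =
      stft (fun y => star (g y)) p + stft (fun y => star (h y)) p := by
  unfold stft
  rw [← MeasureTheory.integral_add
    (stft_integrand_integrable g.continuous.star
      (fun y => by rw [norm_star]; exact SchwartzMap.norm_le_seminorm ℂ g y) p)
    (stft_integrand_integrable h.continuous.star
      (fun y => by rw [norm_star]; exact SchwartzMap.norm_le_seminorm ℂ h y) p)]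
  congr 1
  funext y
  simp only [add_apply, star_add]
  ring

theorem stft_star_smul {d : ℕ} (a : ℂ) (g : SchwartzMap (EuclideanSpace ℝ (Fin d)) ℂ)
    (p : EuclideanSpace ℝ (Fin d) × EuclideanSpace ℝ (Fin d)) :
    stft (fun y => star ((a • g) y)) p = star a * stft (fun y => star (g y)) p := by
  unfold stft
  rw [← MeasureTheory.integral_const_mul]
  congr 1
  funext y
  simp only [smul_apply, smul_eq_mul, star_mul']
  ring

/-- For an integrable `F` on `ℝ^{2d}`, the continuous functional
`g ↦ ∬ F(x, ξ) conj(V_φ(conj g)(x, ξ)) dx dξ` on the Schwartz space. -/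
def stftAdjointCLM {d : ℕ}
    (F : EuclideanSpace ℝ (Fin d) × EuclideanSpace ℝ (Fin d) → ℂ)
    (hF : MeasureTheory.Integrable F) :
    SchwartzMap (EuclideanSpace ℝ (Fin d)) ℂ →L[ℂ] ℂ :=
  SchwartzMap.mkCLMtoNormedSpace
    (fun g => ∫ p, F p * star (stft (fun y => star (g y)) p))
    (fun g h => by
      rw [← MeasureTheory.integral_add (stftAdjoint_integrable hF g)
        (stftAdjoint_integrable hF h)]
      congr 1
      funext p
      rw [stft_star_add, star_add]
      ring)
    (fun a g => by
      rw [RingHom.id_apply, smul_eq_mul, ← MeasureTheory.integral_const_mul]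
      congr 1
      funext p
      rw [stft_star_smul, star_mul', star_star]
      ring)
    (by
      have hI : 0 ≤ ∫ y, gaussWindow d y :=
        MeasureTheory.integral_nonneg (gaussWindow_nonneg d)
      refine ⟨{(0, 0)}, (∫ p, ‖F p‖) * ∫ y, gaussWindow d y, by positivity, fun g => ?_⟩
      rw [Finset.sup_singleton]
      refine (MeasureTheory.norm_integral_le_of_norm_le
        (hF.norm.mul_const (SchwartzMap.seminorm ℂ 0 0 g * ∫ y, gaussWindow d y))
        (Filter.Eventually.of_forall fun p => ?_)).trans_eq ?_
      · rw [norm_mul, norm_star]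
        exact mul_le_mul_of_nonneg_left (norm_stft_le
          (fun y => by rw [norm_star]; exact SchwartzMap.norm_le_seminorm ℂ g y) p) (norm_nonneg _)
      · rw [MeasureTheory.integral_mul_const]
        simp only [schwartzSeminormFamily]
        ring)

open Classical in
/-- The adjoint `V_φ^*` of the short-time Fourier transform, on integrable functions `F` on
`ℝ^{2d}`: the tempered distribution with `(V_φ h, F)_{L²(ℝ^{2d})} = (h, V_φ^* F)_{L²(ℝ^d)}` for
every Schwartz function `h`. (Compactly supported bounded functions are integrable; the value `0`
for non-integrable `F` is a placeholder.) -/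
def stftAdjoint {d : ℕ}
    (F : EuclideanSpace ℝ (Fin d) × EuclideanSpace ℝ (Fin d) → ℂ) :
    TemperedDistribution (EuclideanSpace ℝ (Fin d)) ℂ :=
  if hF : MeasureTheory.Integrable F then
    ContinuousLinearMap.toPointwiseConvergenceCLM _ _ _ _ (stftAdjointCLM F hF)
  else 0

theorem stftAdjoint_apply {d : ℕ}
    {F : EuclideanSpace ℝ (Fin d) × EuclideanSpace ℝ (Fin d) → ℂ}
    (hF : MeasureTheory.Integrable F) (g : SchwartzMap (EuclideanSpace ℝ (Fin d)) ℂ) :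
    stftAdjoint F g = ∫ p, F p * star (stft (fun y => star (g y)) p) := by
  rw [stftAdjoint, dif_pos hF]
  rfl

/-- Membership in `L^∞ ∩ E'`: essentially bounded (and measurable), and vanishing almost
everywhere outside some compact set. -/
def IsBoundedCompactlySupported {X : Type*} [TopologicalSpace X] [MeasureTheory.MeasureSpace X]
    (F : X → ℂ) : Prop :=
  MeasureTheory.MemLp F ⊤ MeasureTheory.volume ∧
    ∃ K : Set X, IsCompact K ∧ ∀ᵐ p, p ∉ K → F p = 0

theorem IsBoundedCompactlySupported.integrable {d : ℕ}
    {F : EuclideanSpace ℝ (Fin d) × EuclideanSpace ℝ (Fin d) → ℂ}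
    (hF : IsBoundedCompactlySupported F) : MeasureTheory.Integrable F := by
  obtain ⟨h1, K, hK, h2⟩ := hF
  have h3 : MeasureTheory.IntegrableOn F K := by
    have : MeasureTheory.IsFiniteMeasure (MeasureTheory.volume.restrict K) :=
      ⟨by rw [MeasureTheory.Measure.restrict_apply_univ]; exact hK.measure_lt_top⟩
    exact (h1.restrict K).integrable le_top
  refine (h3.integrable_indicator hK.measurableSet).congr ?_
  filter_upwards [h2] with p hp
  by_cases h : p ∈ K
  · rw [Set.indicator_of_mem h]
  · rw [Set.indicator_of_notMem h, hp h]

/-- The class `R^∞_{t₁,t₂}(ℂ^d)` of non-negative bounded functions (up to null sets) with support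
in the closed polydisc of radii `t₂`, that depend only on `(|z_1|, …, |z_d|)`, and that are bounded
from below by a positive constant on the open polydisc of radii `t₁`. -/
structure IsRadialClassWith {d : ℕ} (t₁ t₂ : Fin d → ℝ) (χ : (Fin d → ℂ) → ℝ) : Prop where
  memLp_top : MeasureTheory.MemLp χ ⊤ MeasureTheory.volume
  nonneg : ∀ᵐ z, 0 ≤ χ z
  support : ∀ᵐ z : Fin d → ℂ, (¬ ∀ j, ‖z j‖ ≤ t₂ j) → χ z = 0
  radial : ∃ χ₀ : (Fin d → ℝ) → ℝ, ∀ᵐ z, χ z = χ₀ (fun j => ‖z j‖)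
  lower : ∃ c : ℝ, 0 < c ∧ ∀ᵐ z : Fin d → ℂ, (∀ j, ‖z j‖ < t₁ j) → c ≤ χ z

/-- The class `R^∞(ℂ^d)`, the union of the classes `R^∞_{t₁,t₂}(ℂ^d)` over all
`t₁ ≤ t₂` in `ℝ_+^d`. -/
def IsRadialClass {d : ℕ} (χ : (Fin d → ℂ) → ℝ) : Prop :=
  ∃ t₁ t₂ : Fin d → ℝ, (∀ j, 0 < t₁ j) ∧ (∀ j, t₁ j ≤ t₂ j) ∧ IsRadialClassWith t₁ t₂ χ

end

/-!
Put `Q(w) = ∑ w_j²`, `N_α = (2^{|α|} α!)^{-1/2}` and `dμ = χ e^{-|w|²/4} dw`. The short-time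
Fourier transform of a Hermite function is explicit, and it shows that the Hermite coefficients of
`V_φ^* F` are `N_α ∫ F₀(w̄) e^{Q(w̄)/8} e^{-Q(w)/8} w^α dμ(w)`. On the other side, `f` lies in the
Pilipović space precisely when its Hermite coefficients divided by `N_α` decay faster than every
geometric sequence. So the claim is about the moments of products `K(w̄) E(w)`, with `K` and `E`
entire, with respect to the compactly supported measure `μ`, which is invariant under the torus.

Such moments decay superexponentially: invariance allows averaging over the rotations `w ↦ ζ w`,
and since `w̄` is then multiplied by `ζ̄ = ζ⁻¹`, the average is that of a function of `ζ` which is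
holomorphic away from `0`. It can be taken over a small circle, where `(ζ w)^α` is small.

Conversely, monomials are orthogonal for `μ`, and `∫ |w^α|² dμ` is bounded below geometrically, so
any superexponentially decaying sequence is the moment sequence of `K(w̄)` for an entire function
`K`. By the previous paragraph the moments of `K(w̄) e^{Q(w)/8}` decay superexponentially too, so
they are those of `G(w̄)` for some entire `G`. As moments against monomials determine those against
`e^{-Q(w)/8} w^α`, the function `G(w̄) e^{-Q(w)/8}` has the moments of `K(w̄)`, and
`F₀ = G e^{-Q/8}` has the prescribed Hermite coefficients. The completeness of the Hermite functions
concludes.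
-/

noncomputable section
open MeasureTheory Filter Complex
open scoped Real Topology
variable {d : ℕ}

/-! ### Derivatives of the Gaussian -/

/-- The `n`-th derivative of `t ↦ e^{-t²}`, the factor of the Hermite functions in one variable. -/
def gaussDeriv (n : ℕ) : ℝ → ℝ :=
  iteratedDeriv n fun t => Real.exp (-t ^ 2)

theorem gaussDeriv_zero (t : ℝ) : gaussDeriv 0 t = Real.exp (-t ^ 2) := by
  simp [gaussDeriv]

theorem hasDerivAt_gaussDeriv (n : ℕ) (t : ℝ) :
    HasDerivAt (gaussDeriv n) (gaussDeriv (n + 1) t) t := by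
  have hsmooth : ContDiff ℝ ⊤ fun t : ℝ => Real.exp (-t ^ 2) := by fun_prop
  rw [gaussDeriv, gaussDeriv, iteratedDeriv_succ]
  exact (hsmooth.differentiable_iteratedDeriv n (WithTop.coe_lt_top _) t).hasDerivAt

theorem continuous_gaussDeriv (n : ℕ) : Continuous (gaussDeriv n) :=
  continuous_iff_continuousAt.2 fun t => (hasDerivAt_gaussDeriv n t).continuousAt

theorem gaussDeriv_succ (n : ℕ) (t : ℝ) :
    gaussDeriv (n + 1) t = -2 * t * gaussDeriv n t - 2 * n * gaussDeriv (n - 1) t := by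
  induction n generalizing t with
  | zero =>
    have hderiv := ((hasDerivAt_pow 2 t).neg.exp).congr_of_eventuallyEq (.of_forall gaussDeriv_zero)
    rw [(hasDerivAt_gaussDeriv 0 t).unique hderiv, gaussDeriv_zero]
    simp only [Pi.neg_apply, Nat.cast_ofNat, Nat.add_one_sub_one, pow_one, CharP.cast_eq_zero,
      mul_zero, zero_mul, sub_zero]
    ring
  | succ n ih =>
    have hlower :
        HasDerivAt (fun t => 2 * n * gaussDeriv (n - 1) t) (2 * n * gaussDeriv n t) t := by
      cases n with
      | zero => simpa using hasDerivAt_const t (0 : ℝ)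
      | succ n => exact (hasDerivAt_gaussDeriv n t).const_mul _
    have hderiv := (((hasDerivAt_id' t).const_mul (-2)).mul (hasDerivAt_gaussDeriv n t)).sub hlower
    rw [(hasDerivAt_gaussDeriv (n + 1) t).unique
      (hderiv.congr_of_eventuallyEq (.of_forall ih)), Nat.add_sub_cancel]
    push_cast
    ring

theorem mul_gaussDeriv (n : ℕ) (t : ℝ) :
    t * gaussDeriv n t = -(1 / 2) * gaussDeriv (n + 1) t - n * gaussDeriv (n - 1) t := by
  rw [gaussDeriv_succ]
  ring

theorem exists_gaussDeriv_eq_eval_mul_exp (n : ℕ) :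
    ∃ p : Polynomial ℝ, ∀ t, gaussDeriv n t = p.eval t * Real.exp (-t ^ 2) := by
  induction n with
  | zero => exact ⟨1, fun t => by simp [gaussDeriv_zero]⟩
  | succ n ih =>
    obtain ⟨p, hp⟩ := ih
    refine ⟨p.derivative - 2 * Polynomial.X * p, fun t => ?_⟩
    refine (hasDerivAt_gaussDeriv n t).unique ?_
    rw [funext hp]
    refine ((p.hasDerivAt t).mul (hasDerivAt_pow 2 t).neg.exp).congr_deriv ?_
    simp only [Pi.neg_apply, Nat.cast_ofNat, Nat.add_one_sub_one, pow_one, Polynomial.eval_sub,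
      Polynomial.eval_mul, Polynomial.eval_ofNat, Polynomial.eval_X]
    ring

theorem exists_abs_polynomial_eval_le_exp_sq (p : Polynomial ℝ) {ε : ℝ} (hε : 0 < ε) :
    ∃ C, 0 ≤ C ∧ ∀ t, |p.eval t| ≤ C * Real.exp (ε * t ^ 2) := by
  induction p using Polynomial.induction_on' with
  | add p q hp hq =>
    obtain ⟨C, hC, hp⟩ := hp
    obtain ⟨D, hD, hq⟩ := hq
    refine ⟨C + D, add_nonneg hC hD, fun t => ?_⟩
    rw [Polynomial.eval_add, add_mul]
    exact (abs_add_le _ _).trans (add_le_add (hp t) (hq t))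
  | monomial n a =>
    refine ⟨|a| * (1 + n.factorial / ε ^ n), by positivity, fun t => ?_⟩
    have hpow : |t| ^ n ≤ 1 + (t ^ 2) ^ n := by
      rw [← sq_abs, ← pow_mul, mul_comm, pow_mul]
      nlinarith [sq_nonneg (|t| ^ n - 1)]
    have hexp : (t ^ 2) ^ n ≤ n.factorial / ε ^ n * Real.exp (ε * t ^ 2) := by
      have := Real.pow_div_factorial_le_exp (ε * t ^ 2) (by positivity) n
      rw [mul_pow, div_le_iff₀ (by positivity)] at this
      rw [div_mul_eq_mul_div, le_div_iff₀ (by positivity)]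
      linarith
    have hone : 1 ≤ Real.exp (ε * t ^ 2) := Real.one_le_exp (by positivity)
    rw [Polynomial.eval_monomial, abs_mul, abs_pow, mul_assoc, add_mul, one_mul]
    gcongr
    linarith

theorem exists_abs_gaussDeriv_le (n : ℕ) {a : ℝ} (ha : a < 1) :
    ∃ C, 0 ≤ C ∧ ∀ t, |gaussDeriv n t| ≤ C * Real.exp (-a * t ^ 2) := by
  obtain ⟨p, hp⟩ := exists_gaussDeriv_eq_eval_mul_exp n
  obtain ⟨C, hC, hpC⟩ := exists_abs_polynomial_eval_le_exp_sq p (sub_pos.2 ha)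
  refine ⟨C, hC, fun t => ?_⟩
  calc |gaussDeriv n t| = |p.eval t| * Real.exp (-t ^ 2) := by
        rw [hp, abs_mul, Real.abs_exp]
    _ ≤ C * Real.exp ((1 - a) * t ^ 2) * Real.exp (-t ^ 2) := by gcongr; exact hpC t
    _ = C * Real.exp (-a * t ^ 2) := by
        rw [mul_assoc, ← Real.exp_add]
        ring_nf

theorem integrable_gaussDeriv_mul_cexp (n : ℕ) (w : ℂ) :
    Integrable fun t : ℝ => (gaussDeriv n t : ℂ) * cexp (t * w) := by
  obtain ⟨C, -, hbound⟩ := exists_abs_gaussDeriv_le n (a := 1 / 2) (by norm_num)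
  have hgauss : Integrable fun t : ℝ => cexp (-(1 / 2) * t ^ 2 + w * t + 0) :=
    integrable_cexp_quadratic (by norm_num) w 0
  refine (hgauss.norm.const_mul C).mono' ?_ (.of_forall fun t => ?_)
  · have := continuous_gaussDeriv n
    exact Continuous.aestronglyMeasurable (by fun_prop)
  · have hre : (-(1 / 2) * (t : ℂ) ^ 2 + w * t + 0).re = -(1 / 2) * t ^ 2 + (t * w).re := by
      simp only [one_div, ← ofReal_pow, neg_mul, add_zero, add_re, neg_re, mul_re, inv_re, re_ofNat,
        normSq_ofNat, div_self_mul_self', ofReal_re, inv_im, im_ofNat, neg_zero, zero_div,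
        ofReal_im, mul_zero, sub_zero, zero_mul]
      ring
    rw [norm_mul, norm_real, Real.norm_eq_abs, norm_exp, norm_exp, hre, Real.exp_add, ← mul_assoc]
    gcongr
    exact hbound t

theorem integral_gaussDeriv_zero_mul_cexp (w : ℂ) :
    ∫ t : ℝ, (gaussDeriv 0 t : ℂ) * cexp (t * w) = √π * cexp (w ^ 2 / 4) := by
  convert integral_cexp_quadratic (b := -1) (by norm_num) w 0 using 2
  · funext t
    rw [gaussDeriv_zero, ofReal_exp, ← Complex.exp_add]
    push_cast
    ring_nf
  · rw [neg_neg, div_one, Real.sqrt_eq_rpow, ofReal_cpow Real.pi_pos.le]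
    norm_num
  · ring_nf

theorem integral_gaussDeriv_mul_cexp (n : ℕ) (w : ℂ) :
    ∫ t : ℝ, (gaussDeriv n t : ℂ) * cexp (t * w) = (-w) ^ n * (√π * cexp (w ^ 2 / 4)) := by
  induction n with
  | zero => rw [pow_zero, one_mul, integral_gaussDeriv_zero_mul_cexp]
  | succ n ih =>
    have hexp (t : ℝ) : HasDerivAt (fun t : ℝ => cexp (t * w)) (cexp (t * w) * w) t := by
      simpa using ((ofRealCLM.hasDerivAt (x := t)).mul_const w).cexp
    have hparts := integral_mul_deriv_eq_deriv_mul_of_integrable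
      (fun t _ => (hasDerivAt_gaussDeriv n t).ofReal_comp) (fun t _ => hexp t)
      (by simpa [Pi.mul_def, mul_assoc] using (integrable_gaussDeriv_mul_cexp n w).mul_const w)
      (integrable_gaussDeriv_mul_cexp (n + 1) w) (integrable_gaussDeriv_mul_cexp n w)
    simp only [← mul_assoc, integral_mul_const, ih] at hparts
    rw [← neg_eq_iff_eq_neg.2 hparts]
    ring

/-! ### Hermite functions -/

/-- The normalising factor `(2^{|α|} α!)^{-1/2}` of the Hermite function `h_α`. -/
def hermiteScale (α : Fin d → ℕ) : ℝ :=
  (2 ^ (∑ j, α j) * ∏ j, ((α j).factorial : ℝ)) ^ (-(1 / 2 : ℝ))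

theorem hermiteScale_pos (α : Fin d → ℕ) : 0 < hermiteScale α := by
  unfold hermiteScale
  positivity

/-- The function `e^{|x|²/2} ∂^α e^{-|x|²}`, a nonzero multiple of the Hermite function `h_α` for
which the three-term recurrence involves no square roots. -/
def hermiteRaw (α : Fin d → ℕ) (x : EuclideanSpace ℝ (Fin d)) : ℝ :=
  Real.exp (‖x‖ ^ 2 / 2) * ∏ j, gaussDeriv (α j) (x j)

theorem hermiteFun_eq_mul_hermiteRaw (α : Fin d → ℕ) (x : EuclideanSpace ℝ (Fin d)) :
    hermiteFun α x = π ^ (-(d : ℝ) / 4) * (-1) ^ (∑ j, α j) * hermiteScale α * hermiteRaw α x := by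
  simp only [hermiteFun, hermiteScale, hermiteRaw, gaussDeriv]
  ring

theorem exists_hermiteFun_eq_mul_hermiteRaw (α : Fin d → ℕ) :
    ∃ c : ℝ, c ≠ 0 ∧ ∀ x, hermiteFun α x = c * hermiteRaw α x := by
  refine ⟨_, ?_, hermiteFun_eq_mul_hermiteRaw α⟩
  have := hermiteScale_pos α
  have : (-1 : ℝ) ^ (∑ j, α j) ≠ 0 := by simp
  positivity

theorem hermiteRaw_zero (x : EuclideanSpace ℝ (Fin d)) :
    hermiteRaw 0 x = Real.exp (-‖x‖ ^ 2 / 2) := by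
  simp only [hermiteRaw, Pi.zero_apply, gaussDeriv_zero]
  rw [← Real.exp_sum, Finset.sum_neg_distrib, ← EuclideanSpace.real_norm_sq_eq, ← Real.exp_add]
  ring_nf

theorem continuous_hermiteRaw (α : Fin d → ℕ) : Continuous (hermiteRaw α) := by
  have := continuous_gaussDeriv
  unfold hermiteRaw
  fun_prop

theorem continuous_hermiteFun (α : Fin d → ℕ) : Continuous (hermiteFun α) := by
  obtain ⟨c, -, hc⟩ := exists_hermiteFun_eq_mul_hermiteRaw α
  rw [funext hc]
  exact (continuous_hermiteRaw α).const_mul _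

theorem exists_abs_hermiteRaw_le (α : Fin d → ℕ) :
    ∃ C, ∀ x, |hermiteRaw α x| ≤ C * Real.exp (-(1 / 4) * ‖x‖ ^ 2) := by
  choose C _ hC using fun n => exists_abs_gaussDeriv_le n (a := 3 / 4) (by norm_num)
  refine ⟨∏ j, C (α j), fun x => ?_⟩
  calc |hermiteRaw α x| = Real.exp (‖x‖ ^ 2 / 2) * ∏ j, |gaussDeriv (α j) (x j)| := by
        rw [hermiteRaw, abs_mul, Real.abs_exp, Finset.abs_prod]
    _ ≤ Real.exp (‖x‖ ^ 2 / 2) * ∏ j, (C (α j) * Real.exp (-(3 / 4) * x j ^ 2)) := by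
        gcongr with j
        exact hC _ _
    _ = (∏ j, C (α j)) * Real.exp (-(1 / 4) * ‖x‖ ^ 2) := by
        rw [Finset.prod_mul_distrib, ← Real.exp_sum, ← Finset.mul_sum, mul_left_comm,
          ← Real.exp_add, ← EuclideanSpace.real_norm_sq_eq]
        ring_nf

theorem exists_abs_hermiteFun_le (α : Fin d → ℕ) : ∃ C, ∀ x, |hermiteFun α x| ≤ C := by
  obtain ⟨c, -, hc⟩ := exists_hermiteFun_eq_mul_hermiteRaw α
  obtain ⟨C, hC⟩ := exists_abs_hermiteRaw_le α
  refine ⟨|c| * |C|, fun x => ?_⟩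
  have hexp : Real.exp (-(1 / 4) * ‖x‖ ^ 2) ≤ 1 :=
    Real.exp_le_one_iff.2 (by nlinarith [sq_nonneg ‖x‖])
  calc |hermiteFun α x| = |c| * |hermiteRaw α x| := by rw [hc, abs_mul]
    _ ≤ |c| * (|C| * Real.exp (-(1 / 4) * ‖x‖ ^ 2)) := by
        gcongr
        exact (hC x).trans (by gcongr; exact le_abs_self C)
    _ ≤ |c| * |C| := by
        gcongr
        exact mul_le_of_le_one_right (abs_nonneg C) hexp

theorem coord_mul_hermiteRaw (α : Fin d → ℕ) (j : Fin d) (x : EuclideanSpace ℝ (Fin d)) :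
    x j * hermiteRaw α x = -(1 / 2) * hermiteRaw (Function.update α j (α j + 1)) x
      - α j * hermiteRaw (Function.update α j (α j - 1)) x := by
  have hupdate (n : ℕ) : hermiteRaw (Function.update α j n) x = Real.exp (‖x‖ ^ 2 / 2) *
      (gaussDeriv n (x j) * ∏ i ∈ Finset.univ.erase j, gaussDeriv (α i) (x i)) := by
    rw [hermiteRaw, ← Finset.mul_prod_erase _ _ (Finset.mem_univ j), Function.update_self]
    congr 2
    refine Finset.prod_congr rfl fun i hi => ?_
    rw [Function.update_of_ne (Finset.ne_of_mem_erase hi)]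
  have hself := hupdate (α j)
  rw [Function.update_eq_self] at hself
  rw [hupdate, hupdate, hself]
  linear_combination (Real.exp (‖x‖ ^ 2 / 2) *
    ∏ i ∈ Finset.univ.erase j, gaussDeriv (α i) (x i)) * mul_gaussDeriv (α j) (x j)

section InnerProductSpace

variable {V : Type*} [NormedAddCommGroup V] [InnerProductSpace ℝ V] [FiniteDimensional ℝ V]
  [MeasurableSpace V] [BorelSpace V] {E : Type*} [NormedAddCommGroup E]

theorem memLp_two_of_norm_le_exp_neg_sq {q : V → E} (hq : Continuous q) {b C : ℝ} (hb : 0 < b)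
    (hC : ∀ x, ‖q x‖ ≤ C * Real.exp (-b * ‖x‖ ^ 2)) : MemLp q 2 := by
  have hgauss : MemLp (fun x : V => Real.exp (-b * ‖x‖ ^ 2)) 2 := by
    rw [memLp_two_iff_integrable_sq (Continuous.aestronglyMeasurable (by fun_prop))]
    have hint := GaussianFourier.integrable_cexp_neg_mul_sq_norm_add (V := V) (b := 2 * b)
      (by simpa using hb) 0 0
    refine hint.norm.congr (.of_forall fun x => ?_)
    dsimp only
    rw [norm_exp, ← Real.exp_nat_mul]
    simp only [← ofReal_pow, neg_mul, inner_zero_left, ofReal_zero, mul_zero, add_zero, neg_re,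
      mul_re, re_ofNat, ofReal_re, im_ofNat, ofReal_im, sub_zero, mul_im, zero_mul, Nat.cast_ofNat,
      Real.exp_eq_exp]
    ring
  exact (hgauss.const_mul C).mono' hq.aestronglyMeasurable (.of_forall hC)

theorem ae_eq_zero_of_fourier_eq_zero [NormedSpace ℂ E] [CompleteSpace E] {h : V → E}
    (hint : Integrable h) (hF : FourierTransform.fourier h = 0) : h =ᵐ[volume] 0 := by
  refine ae_eq_zero_of_integral_contDiff_smul_eq_zero hint.locallyIntegrable fun g hg hgc => ?_
  have hgc' : HasCompactSupport (ofRealCLM ∘ g) := hgc.comp_left rfl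
  let k : SchwartzMap V ℂ := hgc'.toSchwartzMap (by fun_prop)
  let m : SchwartzMap V ℂ := FourierTransformInv.fourierInv k
  have hm : FourierTransform.fourier (m : V → ℂ) = k := by
    rw [← SchwartzMap.fourier_coe, FourierTransform.fourier_fourierInv_eq k]
  have hflip := VectorFourier.integral_fourierIntegral_smul_eq_flip (μ := volume)
    (ν := volume) (L := innerₗ V) Real.continuous_fourierChar continuous_inner m.integrable hint
  calc ∫ x, g x • h x = ∫ x, FourierTransform.fourier (m : V → ℂ) x • h x := by
        rw [hm]
        exact integral_congr_ae (.of_forall fun x => (Complex.coe_smul (g x) (h x)).symm)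
    _ = ∫ x, m x • FourierTransform.fourier h x := by simpa using! hflip
    _ = 0 := by simp [hF]

end InnerProductSpace

theorem hasSum_integral_mul_pow_div_factorial {X : Type*} [MeasurableSpace X] {μ : Measure X}
    {f q : X → ℂ} (hf : AEStronglyMeasurable f μ) (hq : AEStronglyMeasurable q μ)
    (hint : Integrable (fun x => ‖f x‖ * Real.exp ‖q x‖) μ) :
    HasSum (fun n : ℕ => ∫ x, f x * (q x ^ n / n.factorial) ∂μ) (∫ x, f x * cexp (q x) ∂μ) := by
  refine hasSum_integral_of_dominated_convergence
    (fun n x => ‖f x‖ * (‖q x‖ ^ n / n.factorial))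
    (fun n => hf.mul (by fun_prop)) (fun n => .of_forall fun x => by simp)
    (.of_forall fun x => (Real.summable_pow_div_factorial _).mul_left _) ?_
    (.of_forall fun x => ?_)
  · refine hint.congr (.of_forall fun x => ?_)
    dsimp only
    rw [tsum_mul_left, Real.exp_eq_exp_ℝ, NormedSpace.exp_eq_tsum_div]
  · rw [Complex.exp_eq_exp_ℂ]
    exact (NormedSpace.expSeries_div_hasSum_exp (q x)).mul_left _

/-! ### Completeness of the Hermite functions -/

section Completeness

variable {v : EuclideanSpace ℝ (Fin d) → ℂ}

theorem memLp_two_hermiteRaw (α : Fin d → ℕ) :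
    MemLp (fun x : EuclideanSpace ℝ (Fin d) => (hermiteRaw α x : ℂ)) 2 := by
  obtain ⟨C, hC⟩ := exists_abs_hermiteRaw_le α
  exact memLp_two_of_norm_le_exp_neg_sq (b := 1 / 4)
    (continuous_ofReal.comp (continuous_hermiteRaw α)) (by norm_num) (by simpa using hC)

theorem integral_mul_hermiteRaw_eq_zero (hcoeff : ∀ α, hermiteCoeff v α = 0) (α : Fin d → ℕ) :
    ∫ x, v x * (hermiteRaw α x : ℂ) = 0 := by
  obtain ⟨c, hc, hfun⟩ := exists_hermiteFun_eq_mul_hermiteRaw α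
  refine (mul_eq_zero.1 ?_).resolve_left (ofReal_ne_zero.2 hc)
  rw [← integral_const_mul, ← hcoeff α, hermiteCoeff]
  congr with x
  rw [hfun, ofReal_mul, mul_left_comm]

theorem integrable_mul_inner_pow_mul_hermiteRaw_and_integral_eq_zero (hv : MemLp v 2)
    (hcoeff : ∀ α, hermiteCoeff v α = 0) (ξ : EuclideanSpace ℝ (Fin d)) (n : ℕ) (α : Fin d → ℕ) :
    Integrable (fun x => v x * ((inner ℝ x ξ ^ n * hermiteRaw α x : ℝ) : ℂ)) ∧
      ∫ x, v x * ((inner ℝ x ξ ^ n * hermiteRaw α x : ℝ) : ℂ) = 0 := by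
  induction n generalizing α with
  | zero =>
    simp only [pow_zero, one_mul]
    exact ⟨hv.integrable_mul (memLp_two_hermiteRaw α), integral_mul_hermiteRaw_eq_zero hcoeff α⟩
  | succ n ih =>
    set g := fun (β : Fin d → ℕ) (x : EuclideanSpace ℝ (Fin d)) =>
      v x * ((inner ℝ x ξ ^ n * hermiteRaw β x : ℝ) : ℂ)
    set raise := fun j => Function.update α j (α j + 1)
    set lower := fun j => Function.update α j (α j - 1)
    have hrec (x : EuclideanSpace ℝ (Fin d)) :
        v x * ((inner ℝ x ξ ^ (n + 1) * hermiteRaw α x : ℝ) : ℂ) =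
          ∑ j, (ξ j : ℂ) * (-(1 / 2) * g (raise j) x - α j * g (lower j) x) := by
      have hinner : inner ℝ x ξ * hermiteRaw α x =
          ∑ j, ξ j * (-(1 / 2) * hermiteRaw (raise j) x - α j * hermiteRaw (lower j) x) := by
        simp only [raise, lower, ← coord_mul_hermiteRaw, PiLp.inner_apply, Finset.sum_mul]
        simp [mul_assoc]
      rw [pow_succ, mul_assoc, hinner, Finset.mul_sum, ofReal_sum, Finset.mul_sum]
      refine Finset.sum_congr rfl fun j _ => ?_
      simp only [g]
      push_cast
      ring
    have hint (j : Fin d) :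
        Integrable fun x => (ξ j : ℂ) * (-(1 / 2) * g (raise j) x - α j * g (lower j) x) :=
      (((ih _).1.const_mul _).sub ((ih _).1.const_mul _)).const_mul _
    simp only [hrec]
    refine ⟨integrable_finsetSum _ fun j _ => hint j, ?_⟩
    rw [integral_finsetSum _ fun j _ => hint j]
    refine Finset.sum_eq_zero fun j _ => ?_
    rw [integral_const_mul, integral_sub ((ih _).1.const_mul _) ((ih _).1.const_mul _),
      integral_const_mul, integral_const_mul, (ih _).2, (ih _).2]
    simp

theorem integral_mul_hermiteRaw_zero_mul_cexp_eq_zero (hv : MemLp v 2)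
    (hcoeff : ∀ α, hermiteCoeff v α = 0) (ξ : EuclideanSpace ℝ (Fin d)) :
    ∫ x, v x * (hermiteRaw 0 x : ℂ) * cexp (I * (inner ℝ x ξ : ℝ)) = 0 := by
  have hgauss : MemLp (fun x : EuclideanSpace ℝ (Fin d) =>
      ((hermiteRaw 0 x * Real.exp |inner ℝ x ξ| : ℝ) : ℂ)) 2 := by
    have := continuous_hermiteRaw (0 : Fin d → ℕ)
    refine memLp_two_of_norm_le_exp_neg_sq (b := 1 / 4) (C := Real.exp (‖ξ‖ ^ 2)) (by fun_prop)
      (by norm_num) fun x => ?_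
    rw [norm_real, hermiteRaw_zero, ← Real.exp_add, ← Real.exp_add, Real.norm_eq_abs, Real.abs_exp,
      Real.exp_le_exp]
    nlinarith [sq_nonneg (‖x‖ / 2 - ‖ξ‖), abs_real_inner_le_norm x ξ]
  have hsum := hasSum_integral_mul_pow_div_factorial (f := fun x => v x * (hermiteRaw 0 x : ℂ))
    (q := fun x => I * (inner ℝ x ξ : ℝ))
    (hv.integrable_mul (memLp_two_hermiteRaw 0)).aestronglyMeasurable
    (Continuous.aestronglyMeasurable (by fun_prop))
    ((hv.integrable_mul hgauss).norm.congr (.of_forall fun x => by simp [mul_assoc]))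
  refine hsum.unique ?_
  convert! hasSum_zero (α := ℂ) (β := ℕ) using 1
  funext n
  have hzero := (integrable_mul_inner_pow_mul_hermiteRaw_and_integral_eq_zero hv hcoeff ξ n 0).2
  rw [← mul_zero (I ^ n / n.factorial), ← hzero, ← integral_const_mul]
  congr with x
  push_cast
  ring

theorem ae_eq_zero_of_hermiteCoeff_eq_zero (hv : MemLp v 2)
    (hcoeff : ∀ α, hermiteCoeff v α = 0) : v =ᵐ[volume] 0 := by
  have hfourier : FourierTransform.fourier (fun x => v x * (hermiteRaw 0 x : ℂ)) = 0 := by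
    funext ξ
    rw [Real.fourier_eq', Pi.zero_apply,
      ← integral_mul_hermiteRaw_zero_mul_cexp_eq_zero hv hcoeff ((-2 * π) • ξ)]
    congr with x
    rw [smul_eq_mul, mul_comm, inner_smul_right]
    push_cast
    ring_nf
  filter_upwards [ae_eq_zero_of_fourier_eq_zero
    (hv.integrable_mul (memLp_two_hermiteRaw 0)) hfourier] with x hx
  refine (mul_eq_zero.1 hx).resolve_right ?_
  rw [ofReal_eq_zero, hermiteRaw_zero]
  exact (Real.exp_pos _).ne'

theorem integrable_mul_hermiteFun (hv : MemLp v 2) (α : Fin d → ℕ) :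
    Integrable fun x => v x * (hermiteFun α x : ℂ) := by
  obtain ⟨c, -, hc⟩ := exists_hermiteFun_eq_mul_hermiteRaw α
  refine ((hv.integrable_mul (memLp_two_hermiteRaw α)).const_mul (c : ℂ)).congr
    (.of_forall fun x => ?_)
  simp only [Pi.mul_apply, hc, ofReal_mul]
  ring

theorem ae_eq_of_hermiteCoeff_eq {w : EuclideanSpace ℝ (Fin d) → ℂ} (hv : MemLp v 2)
    (hw : MemLp w 2) (hcoeff : ∀ α, hermiteCoeff v α = hermiteCoeff w α) : v =ᵐ[volume] w := by
  refine sub_ae_eq_zero v w |>.1 (ae_eq_zero_of_hermiteCoeff_eq_zero (hv.sub hw) fun α => ?_)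
  simp only [hermiteCoeff, Pi.sub_apply, sub_mul] at hcoeff ⊢
  rw [integral_sub (integrable_mul_hermiteFun hv α) (integrable_mul_hermiteFun hw α), hcoeff,
    sub_self]

end Completeness

/-! ### The short-time Fourier transform of the Hermite functions -/

section MultiPow

variable {ι R : Type*} [Fintype ι] [CommSemiring R]

/-- The monomial `z^α = ∏ j, z_j^{α_j}`. -/
def multiPow (z : ι → R) (α : ι → ℕ) : R :=
  ∏ j, z j ^ α j

theorem mul_multiPow (z w : ι → R) (α : ι → ℕ) :
    multiPow (z * w) α = multiPow z α * multiPow w α := by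
  simp [multiPow, mul_pow, Finset.prod_mul_distrib]

theorem multiPow_const (s : R) (α : ι → ℕ) : multiPow (fun _ => s) α = s ^ ∑ j, α j :=
  Finset.prod_pow_eq_pow_sum _ _ _

theorem smul_multiPow (s : R) (z : ι → R) (α : ι → ℕ) :
    multiPow (s • z) α = s ^ (∑ j, α j) * multiPow z α := by
  rw [← multiPow_const, ← mul_multiPow]
  rfl

theorem multiPow_mulSingle [DecidableEq ι] (j : ι) (z : R) (α : ι → ℕ) :
    multiPow (Pi.mulSingle j z) α = z ^ α j := by
  rw [multiPow, Finset.prod_eq_single j (fun i _ hi => by simp [hi]) (by simp),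
    Pi.mulSingle_eq_same]

theorem star_multiPow [StarRing R] (z : ι → R) (α : ι → ℕ) :
    star (multiPow z α) = multiPow (star z) α := by
  simp [multiPow]

/-- The bilinear (not Hermitian) square `∑ j, w_j²`. -/
def sumSq (w : ι → R) : R :=
  ∑ j, w j ^ 2

end MultiPow

theorem integral_prod_gaussDeriv_mul_cexp (α : Fin d → ℕ) (w : Fin d → ℂ) :
    ∫ y : EuclideanSpace ℝ (Fin d), (∏ j, (gaussDeriv (α j) (y j) : ℂ)) * cexp (∑ j, y j * w j) =
      (-1) ^ (∑ j, α j) * √π ^ d * multiPow w α * cexp (sumSq w / 4) := by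
  calc ∫ y : EuclideanSpace ℝ (Fin d),
        (∏ j, (gaussDeriv (α j) (y j) : ℂ)) * cexp (∑ j, y j * w j)
      = ∫ y : EuclideanSpace ℝ (Fin d), ∏ j, ((gaussDeriv (α j) (y j) : ℂ) * cexp (y j * w j)) := by
        simp only [Complex.exp_sum, Finset.prod_mul_distrib]
    _ = ∫ y : Fin d → ℝ, ∏ j, ((gaussDeriv (α j) (y j) : ℂ) * cexp (y j * w j)) :=
        (PiLp.volume_preserving_ofLp (Fin d)).integral_comp
          (MeasurableEquiv.toLp 2 (Fin d → ℝ)).symm.measurableEmbedding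
          fun y : Fin d → ℝ => ∏ j, ((gaussDeriv (α j) (y j) : ℂ) * cexp (y j * w j))
    _ = ∏ j, (-w j) ^ α j * (√π * cexp (w j ^ 2 / 4)) := by
        rw [integral_fintype_prod_volume_eq_prod
          fun j (t : ℝ) => (gaussDeriv (α j) t : ℂ) * cexp (t * w j)]
        simp only [integral_gaussDeriv_mul_cexp]
    _ = (-1) ^ (∑ j, α j) * √π ^ d * multiPow w α * cexp (sumSq w / 4) := by
        have hneg : ∏ j, (-w j) ^ α j = (-1) ^ (∑ j, α j) * multiPow w α := by
          rw [← smul_multiPow]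
          simp [multiPow]
        rw [Finset.prod_mul_distrib, Finset.prod_mul_distrib, ← Complex.exp_sum, hneg, sumSq,
          Finset.sum_div, Finset.prod_const, Finset.card_univ, Fintype.card_fin]
        ring

/-- The identification `(x, ξ) ↦ x + iξ` of the phase space `ℝ^{2d}` with `ℂ^d`. -/
def phaseToComplex :
    EuclideanSpace ℝ (Fin d) × EuclideanSpace ℝ (Fin d) ≃ₜ (Fin d → ℂ) where
  toFun p := fun j => (p.1 j : ℂ) + I * (p.2 j : ℂ)
  invFun w := (WithLp.toLp 2 fun j => (w j).re, WithLp.toLp 2 fun j => (w j).im)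
  left_inv p := by ext <;> simp
  right_inv w := by
    ext j
    simp [mul_comm I, re_add_im]
  continuous_toFun := by fun_prop
  continuous_invFun := by fun_prop

theorem phaseToComplex_apply (p : EuclideanSpace ℝ (Fin d) × EuclideanSpace ℝ (Fin d))
    (j : Fin d) : phaseToComplex p j = p.1 j + I * p.2 j := rfl

theorem star_phaseToComplex (p : EuclideanSpace ℝ (Fin d) × EuclideanSpace ℝ (Fin d)) :
    star (phaseToComplex p) = fun j => (p.1 j : ℂ) - I * (p.2 j : ℂ) := by
  funext j
  simp [phaseToComplex_apply, sub_eq_add_neg]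

theorem sum_norm_phaseToComplex_sq (p : EuclideanSpace ℝ (Fin d) × EuclideanSpace ℝ (Fin d)) :
    ∑ j, ‖phaseToComplex p j‖ ^ 2 = ‖p.1‖ ^ 2 + ‖p.2‖ ^ 2 := by
  rw [EuclideanSpace.real_norm_sq_eq, EuclideanSpace.real_norm_sq_eq, ← Finset.sum_add_distrib]
  refine Finset.sum_congr rfl fun j _ => ?_
  rw [← normSq_eq_norm_sq, normSq_apply]
  simp only [phaseToComplex_apply, add_re, ofReal_re, mul_re, I_re, zero_mul, I_im, ofReal_im,
    mul_zero, sub_self, add_zero, add_im, mul_im, one_mul, zero_add]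
  ring

theorem sum_ofReal_mul_ofReal (x y : EuclideanSpace ℝ (Fin d)) :
    ∑ j, (x j : ℂ) * (y j : ℂ) = (inner ℝ x y : ℝ) := by
  simp [PiLp.inner_apply, mul_comm]

theorem sumSq_star_phaseToComplex (p : EuclideanSpace ℝ (Fin d) × EuclideanSpace ℝ (Fin d)) :
    sumSq (star (phaseToComplex p)) =
      ‖p.1‖ ^ 2 - ‖p.2‖ ^ 2 - 2 * (I * (inner ℝ p.1 p.2 : ℝ)) := by
  rw [← ofReal_pow, ← ofReal_pow, EuclideanSpace.real_norm_sq_eq, EuclideanSpace.real_norm_sq_eq,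
    ← sum_ofReal_mul_ofReal, star_phaseToComplex, sumSq, Finset.mul_sum, Finset.mul_sum,
    ofReal_sum, ofReal_sum, ← Finset.sum_sub_distrib, ← Finset.sum_sub_distrib]
  refine Finset.sum_congr rfl fun j _ => ?_
  push_cast
  linear_combination (p.2 j : ℂ) ^ 2 * I_sq

theorem hermiteFun_mul_gaussWindow (α : Fin d → ℕ) (x y : EuclideanSpace ℝ (Fin d)) :
    hermiteFun α y * gaussWindow d (y - x) =
      (-1) ^ (∑ j, α j) * (√π ^ d)⁻¹ * hermiteScale α * Real.exp (-‖x‖ ^ 2 / 2) *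
        ((∏ j, gaussDeriv (α j) (y j)) * Real.exp (inner ℝ y x)) := by
  have hπ : π ^ (-(d : ℝ) / 4) * π ^ (-(d : ℝ) / 4) = (√π ^ d)⁻¹ := by
    rw [Real.sqrt_eq_rpow, ← Real.rpow_natCast, ← Real.rpow_mul Real.pi_pos.le,
      ← Real.rpow_add Real.pi_pos, ← Real.rpow_neg Real.pi_pos.le]
    ring_nf
  have hexp : Real.exp (‖y‖ ^ 2 / 2) * Real.exp (-‖y - x‖ ^ 2 / 2) =
      Real.exp (-‖x‖ ^ 2 / 2) * Real.exp (inner ℝ y x) := by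
    rw [← Real.exp_add, ← Real.exp_add, norm_sub_sq_real]
    ring_nf
  rw [hermiteFun_eq_mul_hermiteRaw, hermiteRaw, gaussWindow, ← hπ]
  linear_combination π ^ (-(d : ℝ) / 4) * π ^ (-(d : ℝ) / 4) * (-1) ^ (∑ j, α j) *
    hermiteScale α * (∏ j, gaussDeriv (α j) (y j)) * hexp

theorem stft_hermiteFun (α : Fin d → ℕ) (p : EuclideanSpace ℝ (Fin d) × EuclideanSpace ℝ (Fin d)) :
    stft (fun y => (hermiteFun α y : ℂ)) p =
      hermiteScale α * multiPow (star (phaseToComplex p)) α *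
        cexp (-(‖p.1‖ ^ 2 + ‖p.2‖ ^ 2) / 4 - I * (inner ℝ p.1 p.2 : ℝ) / 2) := by
  set w := star (phaseToComplex p) with hw
  set c : ℂ := (-1) ^ (∑ j, α j) * (√π ^ d : ℂ)⁻¹ * hermiteScale α * cexp (-‖p.1‖ ^ 2 / 2) with hc
  have hlinear (y : EuclideanSpace ℝ (Fin d)) :
      ∑ j, (y j : ℂ) * w j = (inner ℝ y p.1 : ℝ) - I * (inner ℝ y p.2 : ℝ) := by
    rw [← sum_ofReal_mul_ofReal, ← sum_ofReal_mul_ofReal, Finset.mul_sum,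
      ← Finset.sum_sub_distrib, hw, star_phaseToComplex]
    exact Finset.sum_congr rfl fun j _ => by ring
  have hintegrand (y : EuclideanSpace ℝ (Fin d)) :
      (hermiteFun α y : ℂ) * gaussWindow d (y - p.1) * cexp (-(I * (inner ℝ y p.2 : ℝ))) =
        c * ((∏ j, (gaussDeriv (α j) (y j) : ℂ)) * cexp (∑ j, y j * w j)) := by
    rw [hlinear, sub_eq_add_neg ((inner ℝ y p.1 : ℝ) : ℂ), Complex.exp_add, ← ofReal_mul,
      hermiteFun_mul_gaussWindow, hc]
    push_cast
    ring
  have hsqrt : (√π ^ d : ℂ)⁻¹ * √π ^ d = 1 :=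
    inv_mul_cancel₀ (pow_ne_zero _ (ofReal_ne_zero.2 (by positivity)))
  have hsign : ((-1 : ℂ) ^ ∑ j, α j) * (-1) ^ ∑ j, α j = 1 := by
    rw [← mul_pow]
    norm_num
  calc stft (fun y => (hermiteFun α y : ℂ)) p
      = c * ((-1) ^ (∑ j, α j) * √π ^ d * multiPow w α * cexp (sumSq w / 4)) := by
        rw [stft, ← integral_prod_gaussDeriv_mul_cexp, ← integral_const_mul]
        simp only [hintegrand]
    _ = hermiteScale α * multiPow w α * (cexp (-‖p.1‖ ^ 2 / 2) * cexp (sumSq w / 4)) := by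
        linear_combination hermiteScale α * multiPow w α * cexp (-‖p.1‖ ^ 2 / 2) *
          cexp (sumSq w / 4) * ((√π ^ d : ℂ)⁻¹ * √π ^ d * hsign + hsqrt)
    _ = _ := by
        rw [← Complex.exp_add, hw, sumSq_star_phaseToComplex]
        ring_nf

/-! ### Power series with superexponentially decaying coefficients -/

section PowerSeries

variable {ι : Type*} [Fintype ι]

theorem norm_multiPow_le {𝕜 : Type*} [NormedField 𝕜] {z : ι → 𝕜} {T : ℝ} (hz : ‖z‖ ≤ T)
    (α : ι → ℕ) : ‖multiPow z α‖ ≤ T ^ ∑ j, α j := by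
  rw [multiPow, norm_prod, ← Finset.prod_pow_eq_pow_sum]
  gcongr with j
  rw [norm_pow]
  gcongr
  exact (norm_le_pi_norm z j).trans hz

theorem differentiable_multiPow (α : ι → ℕ) : Differentiable ℂ fun z : ι → ℂ => multiPow z α := by
  unfold multiPow
  fun_prop

theorem summable_pow_sum {s : ℝ} (hs : 0 ≤ s) (hs1 : s < 1) :
    Summable fun α : ι → ℕ => s ^ ∑ j, α j := by
  classical
  refine summable_of_sum_le (c := ∏ _j : ι, (1 - s)⁻¹) (fun α => pow_nonneg hs _) fun u => ?_
  have hu : u ⊆ Fintype.piFinset fun j => u.image (· j) := fun α hα =>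
    Fintype.mem_piFinset.2 fun j => Finset.mem_image_of_mem _ hα
  calc ∑ α ∈ u, s ^ ∑ j, α j
      ≤ ∑ α ∈ Fintype.piFinset fun j => u.image (· j), s ^ ∑ j, α j :=
        Finset.sum_le_sum_of_subset_of_nonneg hu fun α _ _ => pow_nonneg hs _
    _ = ∏ j, ∑ n ∈ u.image (· j), s ^ n := by
        simp only [Finset.prod_univ_sum, Finset.prod_pow_eq_pow_sum]
    _ ≤ ∏ _j : ι, (1 - s)⁻¹ := by
        gcongr with j
        rw [← tsum_geometric_of_lt_one hs hs1]
        exact (summable_geometric_of_lt_one hs hs1).sum_le_tsum _ fun n _ => pow_nonneg hs n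

/-- The multi-indexed sequence `a` decays faster than every geometric sequence `s^{|α|}`. These
are the sequences of Taylor coefficients of the entire functions on `ℂ^ι`. -/
def IsSuperexpDecaying (a : (ι → ℕ) → ℂ) : Prop :=
  ∀ s : ℝ, 0 < s → ∃ C : ℝ, ∀ α, ‖a α‖ ≤ C * s ^ ∑ j, α j

namespace IsSuperexpDecaying

variable {a : (ι → ℕ) → ℂ}

theorem exists_summable_bound (ha : IsSuperexpDecaying a) {T : ℝ} (hT : 0 < T) :
    ∃ u : (ι → ℕ) → ℝ, Summable u ∧ ∀ α z, ‖z‖ ≤ T → ‖a α * multiPow z α‖ ≤ u α := by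
  obtain ⟨C, hC⟩ := ha (1 / (2 * T)) (by positivity)
  refine ⟨fun α => C * (1 / 2) ^ ∑ j, α j,
    (summable_pow_sum (by norm_num) (by norm_num)).mul_left C, fun α z hz => ?_⟩
  calc ‖a α * multiPow z α‖ ≤ (C * (1 / (2 * T)) ^ ∑ j, α j) * T ^ ∑ j, α j := by
        rw [norm_mul]
        exact mul_le_mul (hC α) (norm_multiPow_le hz α) (norm_nonneg _)
          ((norm_nonneg _).trans (hC α))
    _ = C * (1 / 2) ^ ∑ j, α j := by
        rw [mul_assoc, ← mul_pow]
        field_simp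

theorem differentiable_tsum (ha : IsSuperexpDecaying a) :
    Differentiable ℂ fun z => ∑' α, a α * multiPow z α := by
  intro z
  obtain ⟨u, hu, hau⟩ := ha.exists_summable_bound (T := ‖z‖ + 2) (by positivity)
  have hterm (α : ι → ℕ) : Differentiable ℂ fun z => a α * multiPow z α :=
    (differentiable_multiPow α).const_mul _
  have hfderiv (α : ι → ℕ) {x : ι → ℂ} (hx : x ∈ Metric.ball 0 (‖z‖ + 1)) :
      ‖fderiv ℂ (fun z => a α * multiPow z α) x‖ ≤ (u α + u α) / 1 := by
    have hbound {y : ι → ℂ} (hy : dist y x ≤ 1) : ‖a α * multiPow y α‖ ≤ u α := by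
      refine hau α y ((norm_le_norm_add_norm_sub' y x).trans ?_)
      rw [mem_ball_zero_iff] at hx
      rw [dist_eq_norm] at hy
      linarith
    refine Complex.norm_fderiv_le_div_of_mapsTo_ball (hterm α).differentiableOn
      (fun y hy => ?_) one_pos
    rw [Metric.mem_closedBall, dist_eq_norm]
    exact norm_sub_le_of_le (hbound (Metric.mem_ball.1 hy).le) (hbound (by simp))
  exact (hasFDerivAt_tsum_of_isPreconnected ((hu.add hu).div_const 1) Metric.isOpen_ball
    (convex_ball 0 (‖z‖ + 1)).isPreconnected (fun α x _ => (hterm α x).hasFDerivAt)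
    (fun α x hx => hfderiv α hx) (x₀ := z) (by simp)
    (Summable.of_norm_bounded hu fun α => hau α z (by linarith)) (by simp)).differentiableAt

end IsSuperexpDecaying

end PowerSeries

/-! ### Measures that are invariant under the torus -/

section ReinhardtMeasure

variable {ι : Type*} [Fintype ι]

/-- Finite measures on `ℂ^ι` with bounded support that are invariant under the action of the torus
by coordinatewise multiplication. -/
structure IsReinhardtMeasure (μ : Measure (ι → ℂ)) : Prop extends IsFiniteMeasure μ where
  exists_ae_norm_le : ∃ T : ℝ, 0 < T ∧ ∀ᵐ w ∂μ, ‖w‖ ≤ T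
  measurePreserving_mul_left : ∀ u : ι → ℂ, (∀ j, ‖u j‖ = 1) → MeasurePreserving (u * ·) μ μ

theorem IsSuperexpDecaying.div_of_pow_le {a : (ι → ℕ) → ℂ} (ha : IsSuperexpDecaying a)
    {m : (ι → ℕ) → ℝ} {κ ρ : ℝ} (hκ : 0 < κ) (hρ : 0 < ρ) (hm : ∀ α, κ * ρ ^ ∑ j, α j ≤ m α) :
    IsSuperexpDecaying fun α => a α / m α := by
  intro s hs
  obtain ⟨C, hC⟩ := ha (s * ρ) (by positivity)
  have hC0 : 0 ≤ C := by simpa using (norm_nonneg _).trans (hC 0)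
  refine ⟨C / κ, fun α => ?_⟩
  have hmα : 0 < m α := lt_of_lt_of_le (by positivity) (hm α)
  rw [norm_div, norm_real, Real.norm_of_nonneg hmα.le, div_le_iff₀ hmα]
  calc ‖a α‖ ≤ C * (s * ρ) ^ ∑ j, α j := hC α
    _ = C / κ * s ^ (∑ j, α j) * (κ * ρ ^ ∑ j, α j) := by
        rw [mul_pow]
        field_simp
    _ ≤ C / κ * s ^ (∑ j, α j) * m α := by
        gcongr
        exact hm α

theorem exists_measure_forall_le_norm_ne_zero {ι : Type*} [Finite ι] {μ : Measure (ι → ℂ)}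
    (h0 : μ {w | ∀ j, w j ≠ 0} ≠ 0) : ∃ ρ : ℝ, 0 < ρ ∧ μ {w | ∀ j, ρ ≤ ‖w j‖} ≠ 0 := by
  contrapose! h0
  have hcover : {w : ι → ℂ | ∀ j, w j ≠ 0} ⊆ ⋃ n : ℕ, {w | ∀ j, 1 / ((n : ℝ) + 1) ≤ ‖w j‖} := by
    intro w hw
    have hsmall : ∀ᶠ n : ℕ in atTop, ∀ j, 1 / ((n : ℝ) + 1) ≤ ‖w j‖ :=
      eventually_all.2 fun j =>
        tendsto_one_div_add_atTop_nhds_zero_nat.eventually_le_const (norm_pos_iff.2 (hw j))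
    exact Set.mem_iUnion.2 hsmall.exists
  exact measure_mono_null hcover (measure_iUnion_null fun n => h0 _ (by positivity))

namespace IsReinhardtMeasure

variable {μ : Measure (ι → ℂ)}

theorem integrable_of_continuous (hμ : IsReinhardtMeasure μ) {E : Type*} [NormedAddCommGroup E]
    {H : (ι → ℂ) → E} (hH : Continuous H) : Integrable H μ := by
  have := hμ.toIsFiniteMeasure
  obtain ⟨T, -, hT⟩ := hμ.exists_ae_norm_le
  obtain ⟨M, hM⟩ := (isCompact_closedBall (0 : ι → ℂ) T).exists_bound_of_continuousOn
    hH.continuousOn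
  refine Integrable.of_bound hH.aestronglyMeasurable M ?_
  filter_upwards [hT] with w hw using hM w (mem_closedBall_zero_iff.2 hw)

theorem integral_comp_mul_left (hμ : IsReinhardtMeasure μ) {E : Type*} [NormedAddCommGroup E]
    [NormedSpace ℝ E] {u : ι → ℂ} (hu : ∀ j, ‖u j‖ = 1) {H : (ι → ℂ) → E}
    (hH : AEStronglyMeasurable H μ) : ∫ w, H (u * w) ∂μ = ∫ w, H w ∂μ := by
  have hmp := hμ.measurePreserving_mul_left u hu
  conv_rhs => rw [← hmp.map_eq]
  rw [← hmp.map_eq] at hH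
  rw [integral_map hmp.aemeasurable hH]

theorem integral_multiPow_star_mul_multiPow_of_ne (hμ : IsReinhardtMeasure μ) {α β : ι → ℕ}
    (hne : β ≠ α) : ∫ w, multiPow (star w) β * multiPow w α ∂μ = 0 := by
  classical
  obtain ⟨j, hj⟩ := Function.ne_iff.1 hne
  have hsub : (α j : ℂ) - β j ≠ 0 := sub_ne_zero.2 (by exact_mod_cast hj.symm)
  set ζ : ℂ := cexp ((π / ((α j : ℝ) - β j) : ℝ) * I) with hζ
  have hζ_rotation : star ζ ^ β j * ζ ^ α j = -1 := by
    rw [hζ, star_def, ← Complex.exp_conj, ← Complex.exp_nat_mul, ← Complex.exp_nat_mul,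
      ← Complex.exp_add, ← Complex.exp_pi_mul_I]
    congr 1
    simp only [map_mul, conj_ofReal, conj_I]
    push_cast
    field_simp
    ring
  have hstar : star (Pi.mulSingle j ζ : ι → ℂ) = Pi.mulSingle j (star ζ) := by
    funext i
    rcases eq_or_ne i j with rfl | hi <;> simp [*]
  have hunit (i : ι) : ‖(Pi.mulSingle j ζ : ι → ℂ) i‖ = 1 := by
    rcases eq_or_ne i j with rfl | hi
    · rw [Pi.mulSingle_eq_same, hζ, norm_exp_ofReal_mul_I]
    · simp [hi]
  have hcont (γ : ι → ℕ) := (differentiable_multiPow γ).continuous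
  have hrotate := hμ.integral_comp_mul_left hunit
    (H := fun w => multiPow (star w) β * multiPow w α)
    (((hcont β).comp continuous_star).mul (hcont α)).aestronglyMeasurable
  have hneg (w : ι → ℂ) :
      multiPow (star (Pi.mulSingle j ζ * w)) β * multiPow (Pi.mulSingle j ζ * w) α =
        -(multiPow (star w) β * multiPow w α) := by
    rw [star_mul', mul_multiPow, mul_multiPow, hstar, multiPow_mulSingle,
      multiPow_mulSingle]
    linear_combination multiPow (star w) β * multiPow w α * hζ_rotation
  simp only [hneg, integral_neg] at hrotate
  exact self_eq_neg.1 hrotate.symm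

theorem exists_mul_pow_le_integral_norm_multiPow_sq (hμ : IsReinhardtMeasure μ)
    (h0 : μ {w | ∀ j, w j ≠ 0} ≠ 0) : ∃ κ ρ : ℝ, 0 < κ ∧ 0 < ρ ∧
      ∀ α : ι → ℕ, κ * ρ ^ ∑ j, α j ≤ ∫ w, ‖multiPow w α‖ ^ 2 ∂μ := by
  have := hμ.toIsFiniteMeasure
  obtain ⟨ρ, hρ, hμρ⟩ := exists_measure_forall_le_norm_ne_zero h0
  set S : Set (ι → ℂ) := {w | ∀ j, ρ ≤ ‖w j‖} with hS
  have hSmeas : MeasurableSet S := by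
    rw [hS, Set.ofPred_forall]
    exact MeasurableSet.iInter fun j => measurableSet_le measurable_const (by fun_prop)
  refine ⟨μ.real S, ρ ^ 2, ENNReal.toReal_pos hμρ (measure_ne_top _ _), by positivity,
    fun α => ?_⟩
  have hint : Integrable (fun w => ‖multiPow w α‖ ^ 2) μ :=
    hμ.integrable_of_continuous ((differentiable_multiPow α).continuous.norm.pow 2)
  have hle : ∀ w ∈ S, (ρ ^ 2) ^ ∑ j, α j ≤ ‖multiPow w α‖ ^ 2 := by
    intro w hw
    rw [← pow_mul, mul_comm, pow_mul, multiPow, norm_prod, ← Finset.prod_pow_eq_pow_sum]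
    gcongr with j
    rw [norm_pow]
    gcongr
    exact hw j
  calc μ.real S * (ρ ^ 2) ^ ∑ j, α j = ∫ _ in S, (ρ ^ 2) ^ ∑ j, α j ∂μ := by
        rw [setIntegral_const, smul_eq_mul]
    _ ≤ ∫ w in S, ‖multiPow w α‖ ^ 2 ∂μ :=
        setIntegral_mono_on (integrableOn_const (measure_ne_top _ _)) hint.integrableOn hSmeas hle
    _ ≤ ∫ w, ‖multiPow w α‖ ^ 2 ∂μ :=
        setIntegral_le_integral hint (Eventually.of_forall fun w => by positivity)

theorem integral_tsum_mul_multiPow (hμ : IsReinhardtMeasure μ) {b : (ι → ℕ) → ℂ}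
    (hb : IsSuperexpDecaying b) (α : ι → ℕ) :
    ∫ w, (∑' β, b β * multiPow (star w) β) * multiPow w α ∂μ =
      b α * (∫ w, ‖multiPow w α‖ ^ 2 ∂μ : ℝ) := by
  have := hμ.toIsFiniteMeasure
  obtain ⟨T, hT, hTμ⟩ := hμ.exists_ae_norm_le
  obtain ⟨u, hu, hbu⟩ := hb.exists_summable_bound hT
  have hcont (γ : ι → ℕ) := (differentiable_multiPow γ).continuous
  have hterm (β : ι → ℕ) : ∫ w, b β * multiPow (star w) β * multiPow w α ∂μ =
      b β * ∫ w, multiPow (star w) β * multiPow w α ∂μ := by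
    simp only [mul_assoc, integral_const_mul]
  have hdiag (w : ι → ℂ) : multiPow (star w) α * multiPow w α = (‖multiPow w α‖ ^ 2 : ℝ) := by
    rw [← star_multiPow, star_def, conj_mul', ofReal_pow]
  have hsum : HasSum (fun β => ∫ w, b β * multiPow (star w) β * multiPow w α ∂μ)
      (∫ w, (∑' β, b β * multiPow (star w) β) * multiPow w α ∂μ) := by
    refine hasSum_integral_of_dominated_convergence (fun β _ => u β * T ^ ∑ j, α j)
      (fun β => Continuous.aestronglyMeasurable (by fun_prop)) (fun β => ?_)
      (Eventually.of_forall fun _ => hu.mul_right _) (integrable_const _) ?_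
    · filter_upwards [hTμ] with w hw
      have hbβ := hbu β (star w) (by rwa [norm_star])
      rw [norm_mul]
      exact mul_le_mul hbβ (norm_multiPow_le hw α) (norm_nonneg _) ((norm_nonneg _).trans hbβ)
    · filter_upwards [hTμ] with w hw
      exact (Summable.of_norm_bounded hu fun β =>
        hbu β (star w) (by rwa [norm_star])).hasSum.mul_right _
  rw [← integral_complex_ofReal, ← integral_congr_ae (Eventually.of_forall hdiag), ← hterm]
  refine hsum.unique (hasSum_single α fun β hβ => ?_)
  rw [hterm, hμ.integral_multiPow_star_mul_multiPow_of_ne hβ, mul_zero]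

/-- Distinct monomials are orthogonal, so it suffices to divide the prescribed moments by the
squared norms of the monomials. -/
theorem exists_differentiable_integral_mul_multiPow_eq (hμ : IsReinhardtMeasure μ)
    (h0 : μ {w | ∀ j, w j ≠ 0} ≠ 0) {a : (ι → ℕ) → ℂ} (ha : IsSuperexpDecaying a) :
    ∃ K : (ι → ℂ) → ℂ, Differentiable ℂ K ∧ ∀ α, ∫ w, K (star w) * multiPow w α ∂μ = a α := by
  obtain ⟨κ, ρ, hκ, hρ, hmoment⟩ := hμ.exists_mul_pow_le_integral_norm_multiPow_sq h0
  have hb := ha.div_of_pow_le hκ hρ hmoment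
  refine ⟨_, hb.differentiable_tsum, fun α => ?_⟩
  have hpos : 0 < ∫ w, ‖multiPow w α‖ ^ 2 ∂μ := lt_of_lt_of_le (by positivity) (hmoment α)
  rw [hμ.integral_tsum_mul_multiPow hb, div_mul_cancel₀ _ (ofReal_ne_zero.2 hpos.ne')]

end IsReinhardtMeasure

end ReinhardtMeasure

/-! ### Moments of holomorphic functions with respect to torus-invariant measures -/

theorem circleAverage_eq_circleAverage_of_differentiableAt {E : Type*} [NormedAddCommGroup E]
    [NormedSpace ℂ E] [CompleteSpace E] {f : ℂ → E} {c : ℂ}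
    (hf : ∀ z ≠ c, DifferentiableAt ℂ f z) {r R : ℝ} (hr : 0 < r) (hrR : r ≤ R) :
    Real.circleAverage f c R = Real.circleAverage f c r := by
  rw [Real.circleAverage_eq_circleIntegral (hr.trans_le hrR).ne',
    Real.circleAverage_eq_circleIntegral hr.ne',
    Complex.circleIntegral_sub_center_inv_smul_eq_of_differentiable_on_annulus_off_countable
      hr hrR Set.countable_empty]
  · refine fun z hz => (hf z ?_).continuousAt.continuousWithinAt
    rintro rfl
    exact hz.2 (Metric.mem_ball_self hr)
  · refine fun z hz => hf z ?_
    rintro rfl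
    exact hz.1.2 (Metric.mem_closedBall_self hr.le)

theorem norm_circleAverage_le {E : Type*} [NormedAddCommGroup E] [NormedSpace ℝ E] {f : ℂ → E}
    {c : ℂ} {R M : ℝ} (hf : ∀ z ∈ Metric.sphere c |R|, ‖f z‖ ≤ M) :
    ‖Real.circleAverage f c R‖ ≤ M := by
  have hint := intervalIntegral.norm_integral_le_of_norm_le_const (a := 0) (b := 2 * π)
    (f := fun θ => f (circleMap c R θ)) fun θ _ => hf _ (circleMap_mem_sphere' c R θ)
  rw [sub_zero, abs_of_pos Real.two_pi_pos] at hint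
  rw [Real.circleAverage_def, norm_smul, Real.norm_of_nonneg (by positivity),
    inv_mul_le_iff₀ Real.two_pi_pos]
  linarith

namespace IsReinhardtMeasure

variable {ι : Type*} [Fintype ι] {μ : Measure (ι → ℂ)}

theorem integral_eq_integral_circleAverage (hμ : IsReinhardtMeasure μ) {E : Type*}
    [NormedAddCommGroup E] [NormedSpace ℝ E] [CompleteSpace E] {H : (ι → ℂ) → E}
    (hH : Continuous H) :
    ∫ w, H w ∂μ = ∫ w, Real.circleAverage (fun z => H (z • w)) 0 1 ∂μ := by
  have := hμ.toIsFiniteMeasure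
  have hrotate (θ : ℝ) : ∫ w, H (circleMap 0 1 θ • w) ∂μ = ∫ w, H w ∂μ :=
    hμ.integral_comp_mul_left (u := fun _ => circleMap 0 1 θ) (fun _ => by simp)
      hH.aestronglyMeasurable
  have hint : Integrable (Function.uncurry fun w θ => H (circleMap 0 1 θ • w))
      (μ.prod (volume.restrict (Set.Ioc 0 (2 * π)))) := by
    obtain ⟨T, -, hT⟩ := hμ.exists_ae_norm_le
    obtain ⟨M, hM⟩ := (isCompact_closedBall (0 : ι → ℂ) T).exists_bound_of_continuousOn
      hH.continuousOn
    refine Integrable.of_bound (Continuous.aestronglyMeasurable (by fun_prop)) M ?_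
    filter_upwards [Measure.quasiMeasurePreserving_fst.ae hT] with p hp
    exact hM _ (by simpa [norm_smul] using hp)
  simp only [Real.circleAverage_def, intervalIntegral.integral_of_le Real.two_pi_pos.le]
  rw [integral_smul, integral_integral_swap hint]
  simp only [hrotate, setIntegral_const, Real.volume_real_Ioc_of_le Real.two_pi_pos.le, sub_zero,
    inv_smul_smul₀ Real.two_pi_pos.ne']

/-- On the unit circle `star (z • w) = z⁻¹ • star w`, which makes the average over the rotations
`z • w` a mean value of a function holomorphic away from `z = 0`; it can thus be taken over an
arbitrarily small circle. -/
theorem integral_star_mul_eq_integral_circleAverage (hμ : IsReinhardtMeasure μ)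
    {K H : (ι → ℂ) → ℂ} (hK : Differentiable ℂ K) (hH : Differentiable ℂ H) {ε : ℝ} (hε : 0 < ε)
    (hε1 : ε ≤ 1) :
    ∫ w, K (star w) * H w ∂μ =
      ∫ w, Real.circleAverage (fun z => K (z⁻¹ • star w) * H (z • w)) 0 ε ∂μ := by
  have hKc := hK.continuous
  have hHc := hH.continuous
  rw [hμ.integral_eq_integral_circleAverage (H := fun w => K (star w) * H w) (by fun_prop)]
  congr 1
  funext w
  rw [← circleAverage_eq_circleAverage_of_differentiableAt _ hε hε1]
  · refine Real.circleAverage_congr_sphere fun z hz => ?_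
    have hz1 : star z = z⁻¹ := by
      rw [inv_def, normSq_eq_norm_sq, show ‖z‖ = 1 by simpa using hz]
      simp
    simp only [star_smul, hz1]
  · intro z hz
    have hinv : DifferentiableAt ℂ (fun z : ℂ => z⁻¹ • star w) z :=
      (differentiableAt_inv hz).smul_const _
    have hsmul : DifferentiableAt ℂ (fun z : ℂ => z • w) z := by fun_prop
    exact (hK.differentiableAt.comp z hinv).mul (hH.differentiableAt.comp z hsmul)

theorem isSuperexpDecaying_integral_mul_multiPow (hμ : IsReinhardtMeasure μ)
    {K E : (ι → ℂ) → ℂ} (hK : Differentiable ℂ K) (hE : Differentiable ℂ E) :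
    IsSuperexpDecaying fun α => ∫ w, K (star w) * (E w * multiPow w α) ∂μ := by
  intro s hs
  have := hμ.toIsFiniteMeasure
  obtain ⟨T, hT, hTμ⟩ := hμ.exists_ae_norm_le
  set ε : ℝ := min 1 (s / T)
  have hε : 0 < ε := by positivity
  obtain ⟨M, hM⟩ := (isCompact_closedBall (0 : ι → ℂ) (ε⁻¹ * T)).exists_bound_of_continuousOn
    hK.continuous.continuousOn
  obtain ⟨M', hM'⟩ := (isCompact_closedBall (0 : ι → ℂ) s).exists_bound_of_continuousOn
    hE.continuous.continuousOn
  refine ⟨M * M' * μ.real Set.univ, fun α => ?_⟩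
  have hbound {w : ι → ℂ} (hw : ‖w‖ ≤ T) {z : ℂ} (hz : ‖z‖ = ε) :
      ‖K (z⁻¹ • star w) * (E (z • w) * multiPow (z • w) α)‖ ≤ M * (M' * s ^ ∑ j, α j) := by
    have hzw : ‖z • w‖ ≤ s := by
      rw [norm_smul, hz]
      calc ε * ‖w‖ ≤ s / T * T := by
            gcongr
            exact min_le_right _ _
        _ = s := div_mul_cancel₀ s hT.ne'
    have hKz : ‖K (z⁻¹ • star w)‖ ≤ M := hM _ <| by
      rw [mem_closedBall_zero_iff, norm_smul, norm_inv, norm_star, hz]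
      gcongr
    have hEz : ‖E (z • w)‖ ≤ M' := hM' _ (mem_closedBall_zero_iff.2 hzw)
    rw [norm_mul, norm_mul]
    exact mul_le_mul hKz (mul_le_mul hEz (norm_multiPow_le hzw α) (norm_nonneg _)
      ((norm_nonneg _).trans hEz)) (by positivity) ((norm_nonneg _).trans hKz)
  beta_reduce
  rw [hμ.integral_star_mul_eq_integral_circleAverage hK
    (H := fun w => E w * multiPow w α) (hE.mul (differentiable_multiPow α)) hε (min_le_left _ _)]
  calc _ ≤ M * (M' * s ^ ∑ j, α j) * μ.real Set.univ := by
        refine norm_integral_le_of_norm_le_const ?_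
        filter_upwards [hTμ] with w hw
        exact norm_circleAverage_le fun z hz => hbound hw (by simpa [abs_of_pos hε] using hz)
    _ = M * M' * μ.real Set.univ * s ^ ∑ j, α j := by ring

theorem integral_mul_eval_congr (hμ : IsReinhardtMeasure μ) {H₁ H₂ : (ι → ℂ) → ℂ}
    (h₁ : Continuous H₁) (h₂ : Continuous H₂)
    (hmoment : ∀ α, ∫ w, H₁ w * multiPow w α ∂μ = ∫ w, H₂ w * multiPow w α ∂μ)
    (P : MvPolynomial ι ℂ) : ∫ w, H₁ w * P.eval w ∂μ = ∫ w, H₂ w * P.eval w ∂μ := by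
  induction P using MvPolynomial.induction_on' with
  | monomial s a =>
    have hmonomial (w : ι → ℂ) : (MvPolynomial.monomial s a).eval w = a * multiPow w s := by
      rw [MvPolynomial.eval_monomial, Finsupp.prod_fintype _ _ (by simp), multiPow]
    simp only [hmonomial, mul_left_comm _ a, integral_const_mul, hmoment]
  | add P Q hP hQ =>
    have hint {H : (ι → ℂ) → ℂ} (hH : Continuous H) (R : MvPolynomial ι ℂ) :
        Integrable (fun w => H w * R.eval w) μ :=
      hμ.integrable_of_continuous (hH.mul R.continuous_eval)
    simp only [map_add, mul_add]
    rw [integral_add (hint h₁ P) (hint h₁ Q), integral_add (hint h₂ P) (hint h₂ Q), hP, hQ]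

theorem integral_mul_exp_eval_mul_multiPow_congr (hμ : IsReinhardtMeasure μ)
    {H₁ H₂ : (ι → ℂ) → ℂ} (h₁ : Continuous H₁) (h₂ : Continuous H₂)
    (hmoment : ∀ α, ∫ w, H₁ w * multiPow w α ∂μ = ∫ w, H₂ w * multiPow w α ∂μ)
    (Q : MvPolynomial ι ℂ) (α : ι → ℕ) :
    ∫ w, H₁ w * multiPow w α * cexp (Q.eval w) ∂μ =
      ∫ w, H₂ w * multiPow w α * cexp (Q.eval w) ∂μ := by
  have hα := (differentiable_multiPow α).continuous
  have hQ := Q.continuous_eval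
  have hexp {H : (ι → ℂ) → ℂ} (hH : Continuous H) :=
    hasSum_integral_mul_pow_div_factorial (μ := μ) (f := fun w => H w * multiPow w α)
      (q := fun w => Q.eval w) (Continuous.aestronglyMeasurable (by fun_prop))
      hQ.aestronglyMeasurable (hμ.integrable_of_continuous (by fun_prop))
  have hterm (n : ℕ) : ∫ w, H₁ w * multiPow w α * (Q.eval w ^ n / n.factorial) ∂μ =
      ∫ w, H₂ w * multiPow w α * (Q.eval w ^ n / n.factorial) ∂μ := by
    have := hμ.integral_mul_eval_congr h₁ h₂ hmoment
      ((∏ j, MvPolynomial.X j ^ α j) * (Q ^ n * MvPolynomial.C (n.factorial : ℂ)⁻¹))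
    simpa only [multiPow, map_mul, map_prod, map_pow, MvPolynomial.eval_X, MvPolynomial.eval_C,
      div_eq_mul_inv, mul_assoc] using this
  refine (hexp h₁).unique ?_
  simpa only [hterm] using hexp h₂

/-- If `K` has the moments `a` and `G` has the moments of `w ↦ K (star w) * exp (-Q w)`, then
multiplying the latter two by `exp Q` shows that `G` solves the problem. -/
theorem exists_differentiable_integral_mul_exp_eval_mul_multiPow_eq (hμ : IsReinhardtMeasure μ)
    (h0 : μ {w | ∀ j, w j ≠ 0} ≠ 0) {a : (ι → ℕ) → ℂ} (ha : IsSuperexpDecaying a)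
    (Q : MvPolynomial ι ℂ) : ∃ G : (ι → ℂ) → ℂ, Differentiable ℂ G ∧
      ∀ α, ∫ w, G (star w) * (cexp (Q.eval w) * multiPow w α) ∂μ = a α := by
  have hQ : Differentiable ℂ fun w : ι → ℂ => Q.eval w := fun w =>
    (AnalyticOnNhd.eval_mvPolynomial Q w (Set.mem_univ w)).differentiableAt
  obtain ⟨K, hK, hKa⟩ := hμ.exists_differentiable_integral_mul_multiPow_eq h0 ha
  obtain ⟨G, hG, hGK⟩ := hμ.exists_differentiable_integral_mul_multiPow_eq h0
    (hμ.isSuperexpDecaying_integral_mul_multiPow hK (E := fun w => cexp (-Q.eval w)) hQ.neg.cexp)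
  have hKc := hK.continuous
  have hGc := hG.continuous
  have hQc := hQ.continuous
  refine ⟨G, hG, fun α => ?_⟩
  calc ∫ w, G (star w) * (cexp (Q.eval w) * multiPow w α) ∂μ
      = ∫ w, G (star w) * multiPow w α * cexp (Q.eval w) ∂μ := by
        simp only [mul_left_comm, mul_comm, mul_assoc]
    _ = ∫ w, K (star w) * cexp (-Q.eval w) * multiPow w α * cexp (Q.eval w) ∂μ :=
        hμ.integral_mul_exp_eval_mul_multiPow_congr (H₁ := fun w => G (star w))
          (H₂ := fun w => K (star w) * cexp (-Q.eval w)) (by fun_prop) (by fun_prop)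
          (fun β => by simpa only [mul_assoc] using hGK β) Q α
    _ = ∫ w, K (star w) * multiPow w α ∂μ := by
        congr 1
        funext w
        have hcancel : cexp (-Q.eval w) * cexp (Q.eval w) = 1 := by
          rw [← Complex.exp_add, neg_add_cancel, Complex.exp_zero]
        linear_combination K (star w) * multiPow w α * hcancel
    _ = a α := hKa α

end IsReinhardtMeasure

/-! ### The adjoint of the short-time Fourier transform as a function -/

/-- The function `y ↦ ∬ F(x, ξ) φ(y - x) e^{i⟨y, ξ⟩} dx dξ`, which represents the tempered
distribution `stftAdjoint F`. -/
def stftAdjointFun (F : EuclideanSpace ℝ (Fin d) × EuclideanSpace ℝ (Fin d) → ℂ)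
    (y : EuclideanSpace ℝ (Fin d)) : ℂ :=
  ∫ p, F p * (gaussWindow d (y - p.1) * cexp (I * (inner ℝ y p.2 : ℝ)))

section Adjoint

variable {F G : EuclideanSpace ℝ (Fin d) × EuclideanSpace ℝ (Fin d) → ℂ}

theorem norm_gaussWindow_mul_cexp (x ξ y : EuclideanSpace ℝ (Fin d)) :
    ‖(gaussWindow d (y - x) : ℂ) * cexp (I * (inner ℝ y ξ : ℝ))‖ = gaussWindow d (y - x) := by
  rw [norm_mul, norm_real, Real.norm_of_nonneg (gaussWindow_nonneg d _), norm_exp_I_mul_ofReal,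
    mul_one]

theorem gaussWindow_le (x : EuclideanSpace ℝ (Fin d)) :
    gaussWindow d x ≤ π ^ (-(d : ℝ) / 4) :=
  mul_le_of_le_one_right (by positivity)
    (Real.exp_le_one_iff.2 (by linarith [sq_nonneg ‖x‖]))

theorem star_stft (g : EuclideanSpace ℝ (Fin d) → ℂ)
    (p : EuclideanSpace ℝ (Fin d) × EuclideanSpace ℝ (Fin d)) :
    star (stft g p) =
      ∫ y, star (g y) * (gaussWindow d (y - p.1) * cexp (I * (inner ℝ y p.2 : ℝ))) := by
  rw [stft, star_def, ← integral_conj]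
  congr 1
  funext y
  simp [← Complex.exp_conj, mul_assoc]

theorem integrable_stftAdjoint_kernel (hF : Integrable F) :
    Integrable fun q : (EuclideanSpace ℝ (Fin d) × EuclideanSpace ℝ (Fin d)) ×
        EuclideanSpace ℝ (Fin d) =>
      F q.1 * (gaussWindow d (q.2 - q.1.1) * cexp (I * (inner ℝ q.2 q.1.2 : ℝ))) := by
  have hwindow := gaussWindow_continuous d
  rw [Measure.volume_eq_prod, integrable_prod_iff]
  · constructor
    · refine Eventually.of_forall fun p => Integrable.const_mul ?_ (F p)
      exact ((gaussWindow_integrable d).comp_sub_right p.1).mono'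
        (Continuous.aestronglyMeasurable (by fun_prop))
        (Eventually.of_forall fun y => (norm_gaussWindow_mul_cexp p.1 p.2 y).le)
    · simp only [norm_mul (F _), norm_gaussWindow_mul_cexp, integral_const_mul,
        integral_sub_right_eq_self (gaussWindow d)]
      exact hF.norm.mul_const _
  · exact hF.aestronglyMeasurable.comp_fst.mul (Continuous.aestronglyMeasurable (by fun_prop))

theorem integral_stftAdjointFun_mul (hF : Integrable F) {g : EuclideanSpace ℝ (Fin d) → ℂ}
    (hg : Continuous g) {M : ℝ} (hM : ∀ y, ‖g y‖ ≤ M) :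
    ∫ y, stftAdjointFun F y * g y = ∫ p, F p * star (stft (fun y => star (g y)) p) := by
  have hkernel : Integrable fun q : (EuclideanSpace ℝ (Fin d) × EuclideanSpace ℝ (Fin d)) ×
      EuclideanSpace ℝ (Fin d) =>
        F q.1 * (gaussWindow d (q.2 - q.1.1) * cexp (I * (inner ℝ q.2 q.1.2 : ℝ))) * g q.2 :=
    (integrable_stftAdjoint_kernel hF).mul_bdd (c := M)
      (hg.comp continuous_snd).aestronglyMeasurable (Eventually.of_forall fun q => hM q.2)
  simp only [star_stft, star_star, stftAdjointFun, ← integral_mul_const, ← integral_const_mul]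
  rw [← integral_integral_swap hkernel]
  simp only [mul_assoc, mul_comm (g _)]

theorem integrable_stftAdjointFun (hF : Integrable F) : Integrable (stftAdjointFun F) :=
  (integrable_stftAdjoint_kernel hF).swap.integral_prod_left

theorem norm_stftAdjointFun_le (hF : Integrable F) (y : EuclideanSpace ℝ (Fin d)) :
    ‖stftAdjointFun F y‖ ≤ (∫ p, ‖F p‖) * π ^ (-(d : ℝ) / 4) := by
  rw [← integral_mul_const]
  refine norm_integral_le_of_norm_le (hF.norm.mul_const _) (Eventually.of_forall fun p => ?_)
  rw [norm_mul, norm_gaussWindow_mul_cexp]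
  exact mul_le_mul_of_nonneg_left (gaussWindow_le _) (norm_nonneg _)

theorem memLp_two_stftAdjointFun (hF : Integrable F) : MemLp (stftAdjointFun F) 2 := by
  have hint := integrable_stftAdjointFun hF
  rw [memLp_two_iff_integrable_sq_norm hint.aestronglyMeasurable]
  simp only [sq]
  refine hint.norm.mul_bdd (c := (∫ p, ‖F p‖) * π ^ (-(d : ℝ) / 4))
    hint.aestronglyMeasurable.norm (Eventually.of_forall fun y => ?_)
  rw [norm_norm]
  exact norm_stftAdjointFun_le hF y

theorem stftAdjoint_eq_toTemperedDistribution (hF : Integrable F) :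
    stftAdjoint F =
      Lp.toTemperedDistribution ((memLp_two_stftAdjointFun hF).toLp (stftAdjointFun F)) := by
  ext g
  rw [stftAdjoint_apply hF, Lp.toTemperedDistribution_apply, ← integral_stftAdjointFun_mul hF
    g.continuous fun y => SchwartzMap.norm_le_seminorm ℂ g y]
  refine integral_congr_ae ?_
  filter_upwards [(memLp_two_stftAdjointFun hF).coeFn_toLp] with y hy
  rw [hy, smul_eq_mul, mul_comm]

theorem stftAdjoint_congr (hFG : F =ᵐ[volume] G) : stftAdjoint F = stftAdjoint G := by
  by_cases hF : Integrable F
  · ext g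
    rw [stftAdjoint_apply hF, stftAdjoint_apply (hF.congr hFG)]
    refine integral_congr_ae ?_
    filter_upwards [hFG] with p hp
    rw [hp]
  · rw [stftAdjoint, stftAdjoint, dif_neg hF, dif_neg fun hG => hF (hG.congr hFG.symm)]

theorem hermiteCoeff_stftAdjointFun (hF : Integrable F) (α : Fin d → ℕ) :
    hermiteCoeff (stftAdjointFun F) α =
      ∫ p, F p * star (stft (fun y => (hermiteFun α y : ℂ)) p) := by
  obtain ⟨C, hC⟩ := exists_abs_hermiteFun_le α
  rw [hermiteCoeff, integral_stftAdjointFun_mul hF (g := fun y => (hermiteFun α y : ℂ))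
    (continuous_ofReal.comp (continuous_hermiteFun α)) (M := C) fun y =>
      (norm_real _).trans_le (hC y)]
  simp only [star_def, conj_ofReal]

end Adjoint

/-! ### Torus-invariant weights -/

theorem measurePreserving_phaseToComplex : MeasurePreserving (phaseToComplex (d := d)) := by
  have hofLp : MeasurePreserving (Prod.map (WithLp.ofLp (p := 2) (V := Fin d → ℝ))
      (WithLp.ofLp (p := 2) (V := Fin d → ℝ))) :=
    (PiLp.volume_preserving_ofLp (Fin d)).prod (PiLp.volume_preserving_ofLp (Fin d))
  have harrow := (volume_measurePreserving_arrowProdEquivProdArrow ℝ ℝ (Fin d)).symm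
  have hcomplex :
      MeasurePreserving fun (f : Fin d → ℝ × ℝ) j => measurableEquivRealProd.symm (f j) :=
    volume_preserving_pi fun _ => volume_preserving_equiv_real_prod.symm
  convert hcomplex.comp (harrow.comp hofLp) using 1
  funext p j
  apply Complex.ext <;> simp [phaseToComplex_apply] <;> rfl

section Weight

variable {ι : Type*} [Fintype ι]

theorem measurePreserving_mul_left_of_norm_eq_one {u : ι → ℂ} (hu : ∀ j, ‖u j‖ = 1) :
    MeasurePreserving (u * · : (ι → ℂ) → ι → ℂ) :=
  volume_preserving_pi (f := fun j z => u j * z) fun j =>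
    (rotation ⟨u j, mem_sphere_zero_iff_norm.2 (hu j)⟩).measurePreserving

theorem ae_forall_apply_ne_zero : ∀ᵐ w : ι → ℂ, ∀ j, w j ≠ 0 :=
  ae_all_iff.2 fun j => Measure.ae_eval_ne _ j 0

/-- Bounded non-negative weights on `ℂ^ι` with bounded support that are invariant under the torus
and not negligible. All conditions are understood up to null sets. -/
structure IsReinhardtWeight (χ : (ι → ℂ) → ℝ) : Prop where
  memLp_top : MemLp χ ⊤
  nonneg : ∀ᵐ w, 0 ≤ χ w
  exists_ae_eq_zero_of_lt_norm : ∃ T : ℝ, 0 < T ∧ ∀ᵐ w, T < ‖w‖ → χ w = 0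
  ae_mul_left_eq : ∀ u : ι → ℂ, (∀ j, ‖u j‖ = 1) → ∀ᵐ w, χ (u * w) = χ w
  not_ae_eq_zero : ¬ χ =ᵐ[volume] 0

/-- The density `χ(w) e^{-|w|²/4}` with respect to the Lebesgue measure, where `|w|` is the
Euclidean norm. -/
def gaussDensity (χ : (ι → ℂ) → ℝ) (w : ι → ℂ) : ℝ :=
  χ w * Real.exp (-(∑ j, ‖w j‖ ^ 2) / 4)

/-- The measure with density `χ(w) e^{-|w|²/4}`, for a weight `χ ≥ 0`. -/
def gaussMeasure (χ : (ι → ℂ) → ℝ) : Measure (ι → ℂ) :=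
  volume.withDensity fun w => ENNReal.ofReal (gaussDensity χ w)

namespace IsReinhardtWeight

variable {χ : (ι → ℂ) → ℝ}

theorem integrable (hχ : IsReinhardtWeight χ) : Integrable χ := by
  obtain ⟨T, -, hT⟩ := hχ.exists_ae_eq_zero_of_lt_norm
  have hball : IntegrableOn χ (Metric.closedBall 0 T) := by
    have : IsFiniteMeasure (volume.restrict (Metric.closedBall (0 : ι → ℂ) T)) :=
      isFiniteMeasure_restrict.2 measure_closedBall_lt_top.ne
    exact (hχ.memLp_top.restrict _).integrable le_top
  refine hball.integrable_of_ae_notMem_eq_zero ?_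
  filter_upwards [hT] with w hw hwT
  exact hw (by simpa using hwT)

theorem integrable_gaussDensity (hχ : IsReinhardtWeight χ) : Integrable (gaussDensity χ) := by
  refine hχ.integrable.mul_bdd (c := 1) (Continuous.aestronglyMeasurable (by fun_prop))
    (Eventually.of_forall fun w => ?_)
  rw [Real.norm_eq_abs, Real.abs_exp, Real.exp_le_one_iff]
  have hsum : 0 ≤ ∑ j, ‖w j‖ ^ 2 := Finset.sum_nonneg fun j _ => by positivity
  linarith

theorem aemeasurable_ofReal_gaussDensity (hχ : IsReinhardtWeight χ) :
    AEMeasurable fun w => ENNReal.ofReal (gaussDensity χ w) :=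
  hχ.integrable_gaussDensity.aestronglyMeasurable.aemeasurable.ennreal_ofReal

theorem measurePreserving_gaussMeasure (hχ : IsReinhardtWeight χ) {u : ι → ℂ}
    (hu : ∀ j, ‖u j‖ = 1) : MeasurePreserving (u * ·) (gaussMeasure χ) (gaussMeasure χ) := by
  have hmp := measurePreserving_mul_left_of_norm_eq_one hu
  have hemb : MeasurableEmbedding (u * · : (ι → ℂ) → ι → ℂ) := by
    refine hmp.measurable.measurableEmbedding fun w w' hww => funext fun j => ?_
    exact mul_left_cancel₀ (norm_ne_zero_iff.1 (by simp [hu])) (congrFun hww j)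
  refine ⟨hmp.measurable, Measure.ext fun s hs => ?_⟩
  rw [Measure.map_apply hmp.measurable hs, gaussMeasure, withDensity_apply _ (hmp.measurable hs),
    withDensity_apply _ hs, ← hmp.setLIntegral_comp_preimage_emb hemb
      (fun w => ENNReal.ofReal (gaussDensity χ w)) s]
  refine lintegral_congr_ae (ae_restrict_of_ae ?_)
  filter_upwards [hχ.ae_mul_left_eq u hu] with w hw
  simp only [gaussDensity, hw, Pi.mul_apply, norm_mul, hu, one_mul]

theorem isReinhardtMeasure_gaussMeasure (hχ : IsReinhardtWeight χ) :
    IsReinhardtMeasure (gaussMeasure χ) where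
  toIsFiniteMeasure := isFiniteMeasure_withDensity_ofReal hχ.integrable_gaussDensity.2
  exists_ae_norm_le := by
    obtain ⟨T, hT0, hT⟩ := hχ.exists_ae_eq_zero_of_lt_norm
    refine ⟨T, hT0, ?_⟩
    rw [gaussMeasure, ae_withDensity_iff' hχ.aemeasurable_ofReal_gaussDensity]
    filter_upwards [hT] with w hw hdensity
    contrapose! hdensity
    simp [gaussDensity, hw hdensity]
  measurePreserving_mul_left _ hu := hχ.measurePreserving_gaussMeasure hu

theorem gaussMeasure_setOf_forall_ne_zero (hχ : IsReinhardtWeight χ) :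
    gaussMeasure χ {w | ∀ j, w j ≠ 0} ≠ 0 := by
  intro h0
  refine hχ.not_ae_eq_zero ?_
  rw [gaussMeasure, withDensity_apply_eq_zero' hχ.aemeasurable_ofReal_gaussDensity] at h0
  filter_upwards [measure_eq_zero_iff_ae_notMem.1 h0, ae_forall_apply_ne_zero, hχ.nonneg]
    with w hw hw0 hnonneg
  by_contra hne
  refine hw ⟨?_, hw0⟩
  have hpos : 0 < gaussDensity χ w :=
    mul_pos (lt_of_le_of_ne hnonneg (Ne.symm hne)) (Real.exp_pos _)
  simpa using hpos

end IsReinhardtWeight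

end Weight

theorem IsReinhardtWeight.integral_gaussMeasure {χ : (Fin d → ℂ) → ℝ} (hχ : IsReinhardtWeight χ)
    {E : Type*} [NormedAddCommGroup E] [NormedSpace ℝ E] (H : (Fin d → ℂ) → E) :
    ∫ w, H w ∂gaussMeasure χ =
      ∫ p, gaussDensity χ (phaseToComplex p) • H (phaseToComplex p) := by
  rw [measurePreserving_phaseToComplex.integral_comp phaseToComplex.measurableEmbedding
    fun w => gaussDensity χ w • H w, gaussMeasure,
    integral_withDensity_eq_integral_toReal_smul₀ hχ.aemeasurable_ofReal_gaussDensity (by simp)]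
  refine integral_congr_ae ?_
  filter_upwards [hχ.nonneg] with w hw
  rw [ENNReal.toReal_ofReal (by exact mul_nonneg hw (Real.exp_pos _).le)]

theorem IsRadialClass.isReinhardtWeight {χ : (Fin d → ℂ) → ℝ} (hχ : IsRadialClass χ) :
    IsReinhardtWeight χ := by
  obtain ⟨t₁, t₂, ht₁, -, h⟩ := hχ
  refine ⟨h.memLp_top, h.nonneg, ?_, fun u hu => ?_, fun h0 => ?_⟩
  · refine ⟨‖t₂‖ + 1, by positivity, ?_⟩
    filter_upwards [h.support] with w hw hlt
    refine hw fun hle => hlt.not_ge ?_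
    refine (pi_norm_le_iff_of_nonneg (by positivity)).2 fun j => (hle j).trans ?_
    linarith [le_abs_self (t₂ j), norm_le_pi_norm t₂ j, Real.norm_eq_abs (t₂ j)]
  · obtain ⟨χ₀, hχ₀⟩ := h.radial
    filter_upwards [hχ₀,
      (measurePreserving_mul_left_of_norm_eq_one hu).quasiMeasurePreserving.ae hχ₀] with w hw huw
    simp only [huw, hw, Pi.mul_apply, norm_mul, hu, one_mul]
  · obtain ⟨c, hc, hlower⟩ := h.lower
    have hopen : IsOpen {w : Fin d → ℂ | ∀ j, ‖w j‖ < t₁ j} := by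
      simp only [Set.ofPred_forall]
      exact isOpen_iInter_of_finite fun j => isOpen_lt (by fun_prop) continuous_const
    refine (hopen.measure_pos volume ⟨0, fun j => by simpa using ht₁ j⟩).ne'
      (measure_eq_zero_iff_ae_notMem.2 ?_)
    filter_upwards [hlower, h0] with w hw hw0 hwt
    exact (hc.trans_le (hw hwt)).ne' hw0

/-! ### Entire functions cut off by a weight -/

/-- The function `F(x, ξ) = F₀(x - iξ) e^{-i⟨x, ξ⟩} χ(x + iξ)` on `ℝ^{2d}`. -/
def weightedEntire (F₀ : (Fin d → ℂ) → ℂ) (χ : (Fin d → ℂ) → ℝ)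
    (p : EuclideanSpace ℝ (Fin d) × EuclideanSpace ℝ (Fin d)) : ℂ :=
  F₀ (fun j => (p.1 j : ℂ) - I * (p.2 j : ℂ)) * cexp (-(I * (inner ℝ p.1 p.2 : ℝ))) *
    χ (fun j => (p.1 j : ℂ) + I * (p.2 j : ℂ))

theorem IsBoundedCompactlySupported.continuous_mul {X : Type*} [TopologicalSpace X]
    [MeasureSpace X] [OpensMeasurableSpace X] {B F : X → ℂ} (hB : Continuous B)
    (hF : IsBoundedCompactlySupported F) : IsBoundedCompactlySupported fun p => B p * F p := by
  obtain ⟨hmem, K, hK, hFK⟩ := hF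
  obtain ⟨M, hM⟩ := hK.exists_bound_of_continuousOn hB.continuousOn
  refine ⟨hmem.of_le_mul (c := M) (hB.aestronglyMeasurable.mul hmem.1) ?_, K, hK, ?_⟩
  · filter_upwards [hFK] with p hp
    by_cases hpK : p ∈ K
    · rw [norm_mul]
      exact mul_le_mul_of_nonneg_right (hM p hpK) (norm_nonneg _)
    · simp [hp hpK]
  · filter_upwards [hFK] with p hp hpK
    rw [hp hpK, mul_zero]

namespace IsReinhardtWeight

variable {χ : (Fin d → ℂ) → ℝ} {F₀ : (Fin d → ℂ) → ℂ}

theorem isBoundedCompactlySupported_comp_phaseToComplex (hχ : IsReinhardtWeight χ) :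
    IsBoundedCompactlySupported fun p => (χ (phaseToComplex p) : ℂ) := by
  obtain ⟨T, -, hT⟩ := hχ.exists_ae_eq_zero_of_lt_norm
  refine ⟨(hχ.memLp_top.comp_measurePreserving measurePreserving_phaseToComplex).ofReal,
    phaseToComplex ⁻¹' Metric.closedBall 0 T,
    phaseToComplex.isCompact_preimage.2 (isCompact_closedBall _ _), ?_⟩
  filter_upwards [measurePreserving_phaseToComplex.quasiMeasurePreserving.ae hT] with p hp hpT
  rw [hp (by simpa using hpT), ofReal_zero]

theorem isBoundedCompactlySupported_weightedEntire (hχ : IsReinhardtWeight χ)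
    (hF₀ : Continuous F₀) : IsBoundedCompactlySupported (weightedEntire F₀ χ) :=
  hχ.isBoundedCompactlySupported_comp_phaseToComplex.continuous_mul (by fun_prop)

end IsReinhardtWeight

theorem sumSq_star_phaseToComplex_sub (p : EuclideanSpace ℝ (Fin d) × EuclideanSpace ℝ (Fin d)) :
    sumSq (star (phaseToComplex p)) - sumSq (phaseToComplex p) =
      -4 * (I * (inner ℝ p.1 p.2 : ℝ)) := by
  rw [star_phaseToComplex, sumSq, sumSq, ← Finset.sum_sub_distrib, ← sum_ofReal_mul_ofReal,
    Finset.mul_sum, Finset.mul_sum]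
  refine Finset.sum_congr rfl fun j _ => ?_
  rw [phaseToComplex_apply]
  ring

theorem weightedEntire_mul_star_stft_hermiteFun (F₀ : (Fin d → ℂ) → ℂ) (χ : (Fin d → ℂ) → ℝ)
    (α : Fin d → ℕ) (p : EuclideanSpace ℝ (Fin d) × EuclideanSpace ℝ (Fin d)) :
    weightedEntire F₀ χ p * star (stft (fun y => (hermiteFun α y : ℂ)) p) =
      hermiteScale α * gaussDensity χ (phaseToComplex p) •
        (F₀ (star (phaseToComplex p)) * cexp (sumSq (star (phaseToComplex p)) / 8) *
          (cexp (-sumSq (phaseToComplex p) / 8) * multiPow (phaseToComplex p) α)) := by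
  have hstar : star (cexp (-(‖p.1‖ ^ 2 + ‖p.2‖ ^ 2) / 4 - I * (inner ℝ p.1 p.2 : ℝ) / 2)) =
      cexp (-(‖p.1‖ ^ 2 + ‖p.2‖ ^ 2) / 4 + I * (inner ℝ p.1 p.2 : ℝ) / 2) := by
    rw [star_def, ← Complex.exp_conj]
    congr 1
    simp only [map_sub, map_div₀, map_neg, map_add, map_pow, map_mul, map_ofNat, conj_ofReal,
      conj_I]
    ring
  have hexp : cexp (-(I * (inner ℝ p.1 p.2 : ℝ))) *
      cexp (-(‖p.1‖ ^ 2 + ‖p.2‖ ^ 2) / 4 + I * (inner ℝ p.1 p.2 : ℝ) / 2) =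
        Real.exp (-(‖p.1‖ ^ 2 + ‖p.2‖ ^ 2) / 4) *
          (cexp (sumSq (star (phaseToComplex p)) / 8) * cexp (-sumSq (phaseToComplex p) / 8)) := by
    rw [ofReal_exp, ← Complex.exp_add, ← Complex.exp_add, ← Complex.exp_add]
    congr 1
    push_cast
    linear_combination -sumSq_star_phaseToComplex_sub p / 8
  have hF : weightedEntire F₀ χ p = F₀ (star (phaseToComplex p)) *
      cexp (-(I * (inner ℝ p.1 p.2 : ℝ))) * χ (phaseToComplex p) := by
    rw [star_phaseToComplex]
    rfl
  rw [hF, stft_hermiteFun, star_mul', star_mul', hstar, star_multiPow, star_star, star_def,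
    conj_ofReal, real_smul, gaussDensity, sum_norm_phaseToComplex_sq, ofReal_mul]
  linear_combination F₀ (star (phaseToComplex p)) * χ (phaseToComplex p) * hermiteScale α *
    multiPow (phaseToComplex p) α * hexp

theorem IsReinhardtWeight.hermiteCoeff_stftAdjointFun_weightedEntire {χ : (Fin d → ℂ) → ℝ}
    (hχ : IsReinhardtWeight χ) {F₀ : (Fin d → ℂ) → ℂ} (hF₀ : Continuous F₀) (α : Fin d → ℕ) :
    hermiteCoeff (stftAdjointFun (weightedEntire F₀ χ)) α =
      hermiteScale α * ∫ w, F₀ (star w) * cexp (sumSq (star w) / 8) *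
        (cexp (-sumSq w / 8) * multiPow w α) ∂gaussMeasure χ := by
  rw [hermiteCoeff_stftAdjointFun (hχ.isBoundedCompactlySupported_weightedEntire hF₀).integrable,
    hχ.integral_gaussMeasure, ← integral_const_mul]
  simp only [weightedEntire_mul_star_stft_hermiteFun]

/-! ### The decay condition of the Pilipović space -/

theorem isSuperexpDecaying_iff_forall_exists_le_multiPow {ι : Type*} [Fintype ι]
    {a : (ι → ℕ) → ℂ} : IsSuperexpDecaying a ↔
      ∀ r : ι → ℝ, (∀ j, 0 < r j) → ∃ C : ℝ, ∀ α, ‖a α‖ ≤ C * multiPow r α := by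
  constructor
  · intro ha r hr
    obtain ⟨s, hsr, hs⟩ : ∃ s : ℝ, (∀ j, s < r j) ∧ 0 < s := by
      have hsmall : ∀ᶠ s in 𝓝[>] (0 : ℝ), ∀ j, s < r j :=
        eventually_all.2 fun j => nhdsWithin_le_nhds (Iio_mem_nhds (hr j))
      exact (hsmall.and self_mem_nhdsWithin).exists
    obtain ⟨C, hC⟩ := ha s hs
    have hC0 : 0 ≤ C := by simpa using (norm_nonneg _).trans (hC 0)
    refine ⟨C, fun α => (hC α).trans ?_⟩
    rw [← multiPow_const, multiPow, multiPow]
    gcongr with j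
    exact (hsr j).le
  · intro ha s hs
    simpa only [multiPow_const] using ha (fun _ => s) fun _ => hs

theorem thetaFlat_one (r : Fin d → ℝ) (α : Fin d → ℕ) :
    thetaFlat 1 r α = hermiteScale α * multiPow (√2 • r) α := by
  have hsqrt : (2 ^ ∑ j, α j : ℝ) ^ (-(1 / 2 : ℝ)) * √2 ^ ∑ j, α j = 1 := by
    rw [← Real.rpow_pow_comm (by positivity), Real.rpow_neg (by positivity), ← Real.sqrt_eq_rpow,
      ← mul_pow, inv_mul_cancel₀ (by positivity), one_pow]
  rw [smul_multiPow, hermiteScale, Real.mul_rpow (by positivity) (by positivity), thetaFlat,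
    mul_one, multiPow]
  linear_combination -(∏ j, r j ^ α j) * (∏ j, ((α j).factorial : ℝ)) ^ (-(1 / 2 : ℝ)) * hsqrt

theorem forall_exists_le_thetaFlat_one_iff {b : (Fin d → ℕ) → ℂ} :
    (∀ r : Fin d → ℝ, (∀ j, 0 < r j) → ∃ C : ℝ, ∀ α, ‖b α‖ ≤ C * thetaFlat 1 r α) ↔
      IsSuperexpDecaying fun α => b α / hermiteScale α := by
  have hle (r : Fin d → ℝ) (C : ℝ) (α : Fin d → ℕ) : ‖b α‖ ≤ C * thetaFlat 1 r α ↔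
      ‖b α / hermiteScale α‖ ≤ C * multiPow (√2 • r) α := by
    rw [norm_div, norm_real, Real.norm_of_nonneg (hermiteScale_pos α).le,
      div_le_iff₀ (hermiteScale_pos α), thetaFlat_one]
    ring_nf
  simp only [hle]
  rw [isSuperexpDecaying_iff_forall_exists_le_multiPow]
  constructor
  · intro h r hr
    obtain ⟨C, hC⟩ := h ((√2)⁻¹ • r) fun j => mul_pos (by positivity) (hr j)
    exact ⟨C, by simpa only [smul_inv_smul₀ (by positivity : √(2 : ℝ) ≠ 0)] using hC⟩
  · exact fun h r hr => h _ fun j => mul_pos (by positivity) (hr j)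

/-! ### The Pilipović space as a range of the adjoint -/

theorem hermiteCoeff_congr {u v : EuclideanSpace ℝ (Fin d) → ℂ} (huv : u =ᵐ[volume] v)
    (α : Fin d → ℕ) : hermiteCoeff u α = hermiteCoeff v α :=
  integral_congr_ae <| by
    filter_upwards [huv] with x hx
    rw [hx]

theorem differentiable_sumSq : Differentiable ℂ (sumSq : (Fin d → ℂ) → ℂ) := by
  unfold sumSq
  fun_prop

namespace IsReinhardtWeight

variable {χ : (Fin d → ℂ) → ℝ} {F₀ : (Fin d → ℂ) → ℂ}

theorem isSuperexpDecaying_hermiteCoeff_stftAdjointFun (hχ : IsReinhardtWeight χ)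
    (hF₀ : Differentiable ℂ F₀) : IsSuperexpDecaying fun α =>
      hermiteCoeff (stftAdjointFun (weightedEntire F₀ χ)) α / hermiteScale α := by
  have hscale (α : Fin d → ℕ) : (hermiteScale α : ℂ) ≠ 0 :=
    ofReal_ne_zero.2 (hermiteScale_pos α).ne'
  have hsumSq := differentiable_sumSq (d := d)
  simp only [hχ.hermiteCoeff_stftAdjointFun_weightedEntire hF₀.continuous,
    mul_div_cancel_left₀ _ (hscale _)]
  exact hχ.isReinhardtMeasure_gaussMeasure.isSuperexpDecaying_integral_mul_multiPow
    (K := fun z => F₀ z * cexp (sumSq z / 8)) (E := fun w => cexp (-sumSq w / 8))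
    (by fun_prop) (by fun_prop)

theorem stftAdjoint_weightedEntire_mem_pilipovicBeurlingFlat (hχ : IsReinhardtWeight χ)
    (hF₀ : Differentiable ℂ F₀) :
    stftAdjoint (weightedEntire F₀ χ) ∈ pilipovicBeurlingFlat d 1 := by
  have hF := (hχ.isBoundedCompactlySupported_weightedEntire hF₀.continuous).integrable
  refine ⟨_, stftAdjoint_eq_toTemperedDistribution hF, ?_⟩
  simp only [hermiteCoeff_congr (memLp_two_stftAdjointFun hF).coeFn_toLp]
  exact forall_exists_le_thetaFlat_one_iff.2
    (hχ.isSuperexpDecaying_hermiteCoeff_stftAdjointFun hF₀)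

theorem exists_hermiteCoeff_stftAdjointFun_weightedEntire_eq (hχ : IsReinhardtWeight χ)
    {b : (Fin d → ℕ) → ℂ} (hb : IsSuperexpDecaying fun α => b α / hermiteScale α) :
    ∃ F₀ : (Fin d → ℂ) → ℂ, Differentiable ℂ F₀ ∧
      ∀ α, hermiteCoeff (stftAdjointFun (weightedEntire F₀ χ)) α = b α := by
  have hsumSq := differentiable_sumSq (d := d)
  obtain ⟨G, hG, hGb⟩ := hχ.isReinhardtMeasure_gaussMeasure
    |>.exists_differentiable_integral_mul_exp_eval_mul_multiPow_eq
      hχ.gaussMeasure_setOf_forall_ne_zero hb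
      (MvPolynomial.C (-1 / 8) * ∑ j, MvPolynomial.X j ^ 2)
  have heval (w : Fin d → ℂ) :
      MvPolynomial.eval w (MvPolynomial.C (-1 / 8) * ∑ j, MvPolynomial.X j ^ 2) =
        -sumSq w / 8 := by
    simp only [map_mul, MvPolynomial.eval_C, map_sum, map_pow, MvPolynomial.eval_X, sumSq]
    ring
  have hF₀ : Differentiable ℂ fun z => G z * cexp (-sumSq z / 8) := by fun_prop
  refine ⟨_, hF₀, fun α => ?_⟩
  rw [hχ.hermiteCoeff_stftAdjointFun_weightedEntire hF₀.continuous]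
  have hcancel (z : Fin d → ℂ) :
      G z * cexp (-sumSq z / 8) * cexp (sumSq z / 8) = G z := by
    rw [mul_assoc, ← Complex.exp_add, neg_div, neg_add_cancel, Complex.exp_zero, mul_one]
  simp only [heval] at hGb
  simp only [hcancel, hGb]
  exact mul_div_cancel₀ _ (ofReal_ne_zero.2 (hermiteScale_pos α).ne')

theorem exists_eq_stftAdjoint_weightedEntire (hχ : IsReinhardtWeight χ)
    {f : TemperedDistribution (EuclideanSpace ℝ (Fin d)) ℂ} (hf : f ∈ pilipovicBeurlingFlat d 1) :
    ∃ F₀ : (Fin d → ℂ) → ℂ, Differentiable ℂ F₀ ∧ f = stftAdjoint (weightedEntire F₀ χ) := by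
  obtain ⟨u, rfl, hu⟩ := hf
  obtain ⟨F₀, hF₀, hcoeff⟩ := hχ.exists_hermiteCoeff_stftAdjointFun_weightedEntire_eq
    (forall_exists_le_thetaFlat_one_iff.1 hu)
  have hF := (hχ.isBoundedCompactlySupported_weightedEntire hF₀.continuous).integrable
  have hL2 := memLp_two_stftAdjointFun hF
  refine ⟨F₀, hF₀, ?_⟩
  rw [stftAdjoint_eq_toTemperedDistribution hF]
  congr 1
  refine Lp.ext (Filter.EventuallyEq.trans ?_ hL2.coeFn_toLp.symm)
  exact ae_eq_of_hermiteCoeff_eq (Lp.memLp u) hL2 fun α => (hcoeff α).symm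

end IsReinhardtWeight

theorem mainTheorem11_general {χ : (Fin d → ℂ) → ℝ} (hχ : IsReinhardtWeight χ)
    (f : TemperedDistribution (EuclideanSpace ℝ (Fin d)) ℂ) :
    f ∈ pilipovicBeurlingFlat d 1 ↔
      ∃ F : EuclideanSpace ℝ (Fin d) × EuclideanSpace ℝ (Fin d) → ℂ,
        IsBoundedCompactlySupported F ∧
        (∃ F₀ : (Fin d → ℂ) → ℂ, Differentiable ℂ F₀ ∧ F =ᵐ[volume] weightedEntire F₀ χ) ∧
        f = stftAdjoint F := by
  constructor
  · intro hf
    obtain ⟨F₀, hF₀, rfl⟩ := hχ.exists_eq_stftAdjoint_weightedEntire hf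
    exact ⟨weightedEntire F₀ χ, hχ.isBoundedCompactlySupported_weightedEntire hF₀.continuous,
      ⟨F₀, hF₀, ae_eq_rfl⟩, rfl⟩
  · rintro ⟨F, -, ⟨F₀, hF₀, hF⟩, rfl⟩
    rw [stftAdjoint_congr hF]
    exact hχ.stftAdjoint_weightedEntire_mem_pilipovicBeurlingFlat hF₀

end

theorem mainTheorem11 (d : ℕ) (χ : (Fin d → ℂ) → ℝ) (hχ : IsRadialClass χ)
    (f : TemperedDistribution (EuclideanSpace ℝ (Fin d)) ℂ) :
    f ∈ pilipovicBeurlingFlat d 1 ↔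
      ∃ F : EuclideanSpace ℝ (Fin d) × EuclideanSpace ℝ (Fin d) → ℂ,
        IsBoundedCompactlySupported F ∧
        (∃ F₀ : (Fin d → ℂ) → ℂ, Differentiable ℂ F₀ ∧
          ∀ᵐ p : EuclideanSpace ℝ (Fin d) × EuclideanSpace ℝ (Fin d),
            F p = F₀ (fun j => (p.1 j : ℂ) - Complex.I * (p.2 j : ℂ)) *
              Complex.exp (-(Complex.I * ((inner ℝ p.1 p.2 : ℝ) : ℂ))) *
              (χ (fun j => (p.1 j : ℂ) + Complex.I * (p.2 j : ℂ)) : ℂ)) ∧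
        f = stftAdjoint F :=
  mainTheorem11_general hχ.isReinhardtWeight f
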